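/- Let $(\Omega,\mathcal F,P)$ be a probability space with a filtration $\{\mathcal F_t\}_{t\ge 0}$ satisfying the usual conditions, and let $0=T_0\le S_1\le T_1\le S_2\le T_2\le\cdots$ be a.s. finite stopping times with $T_{n-1}<T_n$ and $T_n\to\infty$ a.s. Let $X_u$ be a càdlàg Lévy process with respect to $\{\mathcal F_t\}$ without negative jumps, with $Ee^{-\alpha X_u(t)}=e^{t\varphi(\alpha)}$ for $\alpha\ge0$, where $$\varphi(\alpha)=-c_u\alpha+\tfrac12\sigma_u^2\alpha^2+\int_{(0,\infty)}\bigl(e^{-\alpha x}-1+\alpha x 1_{\{x\le1\}}\bigr)\nu_u(dx),$$ and with $E|X_u(1)|<\infty$, $EX_u(1)=-\varphi'(0)<0$. Let $X_d$ be a right-continuous subordinator with respect to $\{\mathcal F_t\}$ with $Ee^{-\alpha X_d(t)}=e^{-t\eta(\alpha)}$, where $$\eta(\alpha)=c_d\alpha+\int_{(0,\infty)}(1-e^{-\alpha x})\nu_d(dx),\qquad c_d\ge0,$$ and with $EX_d(1)=\eta'(0)<\infty$. ($\nu_u,\nu_d$ are the Lévy measures, and derivatives at $0$ are right derivatives.)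 Put $N(t)=\sup\{n: T_n\le t\}$ and $J(t)=1_{\{S_{N(t)+1}>t\}}$, and for an $\mathcal F_0$-measurable $W(0)$ let $$\tilde X(t)=\int_{(0,t]}(1-J(s-))\,dX_u(s)+\int_{(0,t]}J(s-)\,dX_d(s),$$ $$L(t)=-\inf_{0\le s\le t}\min(W(0)+\tilde X(s),0),\qquad W(t)=W(0)+\tilde X(t)+L(t).$$ Assume that for some finite nonnegative random variable $W(\infty)$ and every $\alpha\ge0$, $$\frac1t\int_0^te^{-\alpha W(s)}ds\to Ee^{-\alpha W(\infty)}\quad\text{a.s. as }t\to\infty,$$ and that $\frac1t\int_0^tJ(s)\,ds\to p_d$ a.s. for a constant $p_d\le\varphi'(0)/(\eta'(0)+\varphi'(0))$. Put $$\pi_\ell=1-\Bigl(1+\frac{\eta'(0)}{\varphi'(0)}\Bigr)p_d,\qquad \pi=\frac{\eta'(0)}{\eta'(0)+\varphi'(0)}.$$ Let $W_u,Y_e,I_\ell,I,W_d$ be independent real random variables such that * $W_u$ is distributed as $\sup_{s\ge0}X_u(s)$; * if $\eta'(0)>0$, then $Y_e$ has the generalized stationary-excess law of $X_d$, with distribution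 function $F_e(y)=\bigl(c_d+\int_0^y\nu_d(x,\infty)\,dx\bigr)\big/\bigl(c_d+\int_{(0,\infty)}x\,\nu_d(dx)\bigr)$ for $y\ge0$ and $F_e(y)=0$ for $y<0$ (if $\eta'(0)=0$, then $\pi=0$ and $Y_e$ is arbitrary); * $P(I_\ell=1)=1-P(I_\ell=0)=\pi_\ell$ and $P(I=1)=1-P(I=0)=\pi$; * $W_d\ge 0$, and if $p_d>0$ then $W_d$ has the ergodic law of the content during down periods: for every $\alpha\ge0$, a.s. as $t\to\infty$, $\int_0^te^{-\alpha W(s)}J(s)\,ds\big/\int_0^tJ(s)\,ds\to Ee^{-\alpha W_d}$. Then $\sup_{s\ge0}X_u(s)<\infty$ a.s., and for all $\alpha>0$ we have $Ee^{-\alpha W_u}=\alpha\varphi'(0)/\varphi(\alpha)$ and, if $\eta'(0)>0$, $Ee^{-\alpha Y_e}=\eta(\alpha)/(\eta'(0)\alpha)$. Moreover, the identity $$Ee^{-\alpha W(\infty)}=\pi_\ell\frac{\varphi'(0)\alpha}{\varphi(\alpha)}+(1-\pi_\ell)\left(1-\pi+\pi\,\frac{\eta(\alpha)}{\eta'(0)\alpha}\,\frac{\varphi'(0)\alpha}{\varphi(\alpha)}\right)Ee^{-\alpha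 W_d}\quad\text{for all }\alpha>0$$ (where the term with the factor $\pi$ is read as $0$ if $\eta'(0)=0$) is equivalent to $$W(\infty)\sim I_\ell W_u+(1-I_\ell)\bigl(I(W_u+Y_e)+W_d\bigr).$$ -/

import Mathlib

open MeasureTheory ProbabilityTheory Filter Topology Set
open scoped NNReal ENNReal

noncomputable section

namespace LevyStorage

variable {Ω : Type*} {m : MeasurableSpace Ω}

/-- The usual conditions: right continuity, and every null set belongs to `𝓕 0`. -/
structure IsStandardFiltration (𝓕 : Filtration ℝ≥0 m) (P : Measure Ω) : Prop where
  rightContinuous : 𝓕.IsRightContinuous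
  complete : ∀ s : Set Ω, P s = 0 → MeasurableSet[𝓕 0] s

/-- A real-valued càdlàg Lévy process with respect to the filtration `𝓕`. -/
structure IsLevyProcess (X : ℝ≥0 → Ω → ℝ) (𝓕 : Filtration ℝ≥0 m) (P : Measure Ω) : Prop where
  adapted : Adapted 𝓕 X
  zero : ∀ᵐ ω ∂P, X 0 ω = 0
  rightCont : ∀ᵐ ω ∂P, ∀ t, ContinuousWithinAt (fun s => X s ω) (Ici t) t
  leftLim : ∀ᵐ ω ∂P, ∀ t, ∃ l, Tendsto (fun s => X s ω) (𝓝[<] t) (𝓝 l)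
  indep : ∀ s t, s ≤ t →
    Indep (MeasurableSpace.comap (fun ω => X t ω - X s ω) inferInstance) (𝓕 s) P
  stationary : ∀ s t, s ≤ t → IdentDistrib (fun ω => X t ω - X s ω) (X (t - s)) P P

/-- Almost every path has no negative jumps: `X (t-) ≤ X t` for `t > 0`. -/
def NoNegativeJumps (X : ℝ≥0 → Ω → ℝ) (P : Measure Ω) : Prop :=
  ∀ᵐ ω ∂P, ∀ t, 0 < t → ∀ l, Tendsto (fun s => X s ω) (𝓝[<] t) (𝓝 l) → l ≤ X t ω

/-- A subordinator: a Lévy process with nondecreasing paths. -/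
structure IsSubordinator (X : ℝ≥0 → Ω → ℝ) (𝓕 : Filtration ℝ≥0 m) (P : Measure Ω) : Prop where
  levy : IsLevyProcess X 𝓕 P
  mono : ∀ᵐ ω ∂P, Monotone fun t => X t ω

/-- `ψ` is the Laplace-Stieltjes exponent of `X`: `E exp (-α X(t)) = exp (t ψ(α))`. (Since the
right-hand side is nonzero, `exp (-α X(t))` is integrable.) -/
def HasLaplaceExponent (X : ℝ≥0 → Ω → ℝ) (ψ : ℝ → ℝ) (P : Measure Ω) : Prop :=
  ∀ α : ℝ, 0 ≤ α → ∀ t : ℝ≥0, ∫ ω, Real.exp (-α * X t ω) ∂P = Real.exp (t * ψ α)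

/-- Lévy measure concentrated on `(0, ∞)`. -/
def IsLevyMeasure (ν : Measure ℝ) : Prop :=
  ν (Iic 0) = 0 ∧ ∫⁻ x, ENNReal.ofReal (min 1 (x ^ 2)) ∂ν < ∞

/-- Lévy measure of a subordinator. -/
def IsSubordinatorLevyMeasure (ν : Measure ℝ) : Prop :=
  ν (Iic 0) = 0 ∧ ∫⁻ x, ENNReal.ofReal (min 1 x) ∂ν < ∞

/-- The exponent `φ` of a Lévy process without negative jumps, from its triplet. -/
def upExponent (c σ : ℝ) (ν : Measure ℝ) (α : ℝ) : ℝ :=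
  -c * α + σ ^ 2 * α ^ 2 / 2
    + ∫ x in Ioi 0, (Real.exp (-α * x) - 1 + α * x * (Iic (1 : ℝ)).indicator 1 x) ∂ν

/-- The function `η` of a subordinator (whose exponent is `-η`), from its drift and Lévy
measure. -/
def downExponent (c : ℝ) (ν : Measure ℝ) (α : ℝ) : ℝ :=
  c * α + ∫ x in Ioi 0, (1 - Real.exp (-α * x)) ∂ν

/-- The right derivative at zero. -/
def rightDerivZero (f : ℝ → ℝ) : ℝ := derivWithin f (Ici 0) 0

/-- The generalized stationary excess law of a subordinator with drift `c` and Lévy measure `ν`: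
with `ν̄ = ∫ x ν(dx)`, mass `c / (c + ν̄)` at zero and density `ν (x, ∞) / (c + ν̄)` on `(0, ∞)`. -/
def stationaryExcess (c : ℝ) (ν : Measure ℝ) : Measure ℝ :=
  (ENNReal.ofReal c + ∫⁻ x in Ioi 0, ENNReal.ofReal x ∂ν)⁻¹ •
    (ENNReal.ofReal c • Measure.dirac 0
      + (volume.restrict (Ioi 0)).withDensity fun x => ν (Ioi x))

/-- `0 = T₀ ≤ S₁ ≤ T₁ ≤ S₂ ≤ T₂ ≤ …` are almost surely finite stopping times with
`Tₙ < Tₙ₊₁` and `Tₙ → ∞`. The value `S 0` plays no role. -/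
structure IsUpDownSchedule (S T : ℕ → Ω → WithTop ℝ≥0) (𝓕 : Filtration ℝ≥0 m)
    (P : Measure Ω) : Prop where
  stopping_S : ∀ n, IsStoppingTime 𝓕 (S (n + 1))
  stopping_T : ∀ n, IsStoppingTime 𝓕 (T n)
  finite_S : ∀ n, ∀ᵐ ω ∂P, S (n + 1) ω ≠ ⊤
  finite_T : ∀ n, ∀ᵐ ω ∂P, T n ω ≠ ⊤
  zero : ∀ᵐ ω ∂P, T 0 ω = 0
  le_S : ∀ n, ∀ᵐ ω ∂P, T n ω ≤ S (n + 1) ω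
  S_le : ∀ n, ∀ᵐ ω ∂P, S (n + 1) ω ≤ T (n + 1) ω
  lt : ∀ n, ∀ᵐ ω ∂P, T n ω < T (n + 1) ω
  unbounded : ∀ᵐ ω ∂P, ∀ t : ℝ≥0, ∃ n, (t : WithTop ℝ≥0) < T n ω

/-- `N(t) = sup {n | Tₙ ≤ t}`. -/
def cycleCount (T : ℕ → Ω → WithTop ℝ≥0) (t : ℝ≥0) (ω : Ω) : ℕ :=
  sSup {n | T n ω ≤ (t : WithTop ℝ≥0)}

open Classical in
/-- `J(t) = 1` if `S_{N(t)+1} > t` (down period), and `J(t) = 0` otherwise (up period). -/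
def downIndicator (S T : ℕ → Ω → WithTop ℝ≥0) (t : ℝ≥0) (ω : Ω) : ℝ :=
  if (t : WithTop ℝ≥0) < S (cycleCount T t ω + 1) ω then 1 else 0

/-- The stochastic integral `∫_{(0,t]} J(s-) dX(s)`. The integrand is the indicator of the union
of the stochastic intervals `(Tₙ, Sₙ₊₁]`, so the integral is the sum of the increments
`X(Sₙ₊₁ ∧ t) - X(Tₙ ∧ t)`, which vanish for `n > N(t)`. -/
def downIntegral (S T : ℕ → Ω → WithTop ℝ≥0) (X : ℝ≥0 → Ω → ℝ) (t : ℝ≥0) (ω : Ω) : ℝ :=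
  ∑ n ∈ Finset.range (cycleCount T t ω + 1),
    (stoppedProcess X (S (n + 1)) t ω - stoppedProcess X (T n) t ω)

/-- The stochastic integral `∫_{(0,t]} (1 - J(s-)) dX(s)`. The integrand is the indicator of the
union of the stochastic intervals `(Sₙ₊₁, Tₙ₊₁]`. -/
def upIntegral (S T : ℕ → Ω → WithTop ℝ≥0) (X : ℝ≥0 → Ω → ℝ) (t : ℝ≥0) (ω : Ω) : ℝ :=
  ∑ n ∈ Finset.range (cycleCount T t ω + 1),
    (stoppedProcess X (T (n + 1)) t ω - stoppedProcess X (S (n + 1)) t ω)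

/-- `X̃(t)`, the net input up to time `t`. -/
def netInput (S T : ℕ → Ω → WithTop ℝ≥0) (Xu Xd : ℝ≥0 → Ω → ℝ) (t : ℝ≥0) (ω : Ω) : ℝ :=
  upIntegral S T Xu t ω + downIntegral S T Xd t ω

/-- `L(t) = - inf_{0 ≤ s ≤ t} min (W(0) + X̃(s)) 0`. -/
def regulator (S T : ℕ → Ω → WithTop ℝ≥0) (Xu Xd : ℝ≥0 → Ω → ℝ) (W0 : Ω → ℝ)
    (t : ℝ≥0) (ω : Ω) : ℝ :=
  -⨅ s : Icc (0 : ℝ≥0) t, min (W0 ω + netInput S T Xu Xd s ω) 0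

/-- The content process `W(t) = W(0) + X̃(t) + L(t)`. -/
def content (S T : ℕ → Ω → WithTop ℝ≥0) (Xu Xd : ℝ≥0 → Ω → ℝ) (W0 : Ω → ℝ)
    (t : ℝ≥0) (ω : Ω) : ℝ :=
  W0 ω + netInput S T Xu Xd t ω + regulator S T Xu Xd W0 t ω

/-- The path integral `∫_0^t Z(s) ds`. -/
def timeIntegral (Z : ℝ≥0 → Ω → ℝ) (t : ℝ) (ω : Ω) : ℝ :=
  ∫ s in (0 : ℝ)..t, Z s.toNNReal ω

variable {Ω' : Type*} {m' : MeasurableSpace Ω'}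

/-- `V` is a nonnegative random variable whose law is the ergodic law of the process `W`: for
every `α ≥ 0`, almost surely `(1/t) ∫_0^t exp (-α W(s)) ds → E exp (-α V)`. -/
structure IsErgodicLimit (W : ℝ≥0 → Ω → ℝ) (P : Measure Ω) (V : Ω' → ℝ) (P' : Measure Ω') :
    Prop where
  aemeasurable : AEMeasurable V P'
  nonneg : ∀ᵐ ω ∂P', 0 ≤ V ω
  tendsto : ∀ α : ℝ, 0 ≤ α → ∀ᵐ ω ∂P,
    Tendsto (fun t : ℝ => (1 / t) * timeIntegral (fun s ω => Real.exp (-α * W s ω)) t ω) atTop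
      (𝓝 (∫ ω', Real.exp (-α * V ω') ∂P'))

/-- `V` is a nonnegative random variable which, if the long-run fraction `p` of time with `J = 1`
is positive, has the ergodic law of `W` restricted to the times with `J = 1`. -/
structure IsDownLimit (W J : ℝ≥0 → Ω → ℝ) (p : ℝ) (P : Measure Ω) (V : Ω' → ℝ)
    (P' : Measure Ω') : Prop where
  aemeasurable : AEMeasurable V P'
  nonneg : ∀ᵐ ω ∂P', 0 ≤ V ω
  tendsto : 0 < p → ∀ α : ℝ, 0 ≤ α → ∀ᵐ ω ∂P,
    Tendsto (fun t : ℝ => timeIntegral (fun s ω => Real.exp (-α * W s ω) * J s ω) t ω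
        / timeIntegral J t ω) atTop
      (𝓝 (∫ ω', Real.exp (-α * V ω') ∂P'))

/-- `P(B = 1) = 1 - P(B = 0) = p`. -/
structure IsBernoulli (B : Ω → ℝ) (p : ℝ) (P : Measure Ω) : Prop where
  aemeasurable : AEMeasurable B P
  one : P.real {ω | B ω = 1} = p
  zero : P.real {ω | B ω = 0} = 1 - p

end LevyStorage

end

namespace LevyStorage

/-! Laplace transforms determine the laws of nonnegative variables (`identDistrib_of_laplace`), and
the right side of the transform identity is the transform of the proposed mixture: split over the
values of the two Bernoulli variables and use independence (`laplace_mixture`). What remains is to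
compute the transforms of the ingredients. For the stationary excess, Tonelli's theorem gives `∫₀^∞
e^{-αx} ν(x,∞) dx = ∫ (1 - e^{-αy})/α ν(dy)` (`laplace_stationaryExcess`). For the supremum it is
the Pollaczek–Khinchine formula (`IsLevyProcess.laplace_sup`), obtained from random walks.

On the grid of mesh `h = 2⁻ᵏ` the process is a random walk with first step `ξ`. Its supremum
satisfies Lindley's recursion `M = (ξ + M')⁺`, with `M'` a copy of `M` independent of `ξ`. Put `D =
(ξ + M')⁻`. Expectations in `e^{αD} = e^{-α(ξ+M')} + 1 - e^{-αM}` give `(e^{hφ(α)} - 1) E e^{-αM} =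
E e^{αD} - 1`, and the right derivative at `α = 0` gives `E D = -E ξ = hφ'(0)`. If `E D² e^{αD} =
o(h)`, dividing by `h` yields `E e^{-αM} → αφ'(0)/φ(α)`; right continuity of the paths identifies
the limit of `M`.

The crux is that remainder (`tendsto_integral_sq_exp_deficit`). As the Lévy measure lives on
`(0,∞)`, `φ` grows at most quadratically, so `ξ⁻/√h` has bounded exponential moments; this alone
yields only `O(h)`. The gain comes from a dichotomy. Either `M'` is rarely below some `δ`, and `D >
0` forces `M' < δ` or `ξ⁻ ≥ δ`, which is unlikely at scale `√h`. Or `M'` is below every `δ` with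
probability bounded away from zero; then `E D` dominates a multiple of `E ξ⁻`, so `E ξ⁻ = O(h)` and
`ξ⁻/√h` tends to zero in mean, hence by interpolation in the moment needed. -/

/-! ### Uniqueness of Laplace transforms on the half-line. -/

open BoundedContinuousFunction in
/-- The bounded continuous function `x ↦ exp (-x)` on `ℝ≥0`. -/
noncomputable def expNegBCF : ℝ≥0 →ᵇ ℝ :=
  BoundedContinuousFunction.mkOfBound
    ⟨fun x => Real.exp (-(x : ℝ)), by fun_prop⟩ 1 (fun x y => by
      have h1 : Real.exp (-(x : ℝ)) ≤ 1 := Real.exp_le_one_iff.2 (by simp)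
      have h2 : Real.exp (-(y : ℝ)) ≤ 1 := Real.exp_le_one_iff.2 (by simp)
      have h3 := Real.exp_pos (-(x : ℝ))
      have h4 := Real.exp_pos (-(y : ℝ))
      simp only [ContinuousMap.coe_mk, Real.dist_eq, abs_le]
      constructor <;> linarith)

lemma expNegBCF_apply (x : ℝ≥0) : expNegBCF x = Real.exp (-(x : ℝ)) := rfl

/-- A finite measure on `ℝ≥0` is determined by its Laplace transform at the integers. -/
lemma measure_nnreal_ext_of_laplace {μ ν : Measure ℝ≥0} [IsFiniteMeasure μ] [IsFiniteMeasure ν]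
    (h : ∀ n : ℕ, ∫ x, Real.exp (-(n : ℝ) * x) ∂μ = ∫ x, Real.exp (-(n : ℝ) * x) ∂ν) :
    μ = ν := by
  -- The polynomials in `e^{-x}` separate points, so they determine a finite measure on the Polish
  -- space `ℝ≥0`; their integrals are combinations of Laplace transforms at the natural numbers.
  let A : StarSubalgebra ℝ (BoundedContinuousFunction ℝ≥0 ℝ) :=
    { Algebra.adjoin ℝ {expNegBCF} with
      star_mem' := fun {a} ha => by
        have : star a = a := by ext x; simp
        rwa [this] }
  refine ext_of_forall_mem_subalgebra_integral_eq_of_pseudoEMetric_complete_countable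
    (𝕜 := ℝ) (A := A) ?_ ?_
  · intro x y hxy
    refine ⟨expNegBCF, ⟨expNegBCF.toContinuousMap, ⟨expNegBCF, ?_, rfl⟩, rfl⟩, ?_⟩
    · exact Algebra.subset_adjoin (by simp)
    · simpa [expNegBCF_apply] using hxy
  · intro g hg
    have hg' : g ∈ Algebra.adjoin ℝ {expNegBCF} := hg
    rw [Algebra.adjoin_singleton_eq_range_aeval] at hg'
    obtain ⟨p, rfl⟩ := hg'
    have key : ∀ (ρ : Measure ℝ≥0) [IsFiniteMeasure ρ],
        ∫ x, (Polynomial.aeval expNegBCF p : BoundedContinuousFunction ℝ≥0 ℝ) x ∂ρ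
          = ∑ n ∈ Finset.range (p.natDegree + 1),
              p.coeff n * ∫ x, Real.exp (-(n : ℝ) * x) ∂ρ := by
      intro ρ _
      have e : ∀ x : ℝ≥0, (Polynomial.aeval expNegBCF p : BoundedContinuousFunction ℝ≥0 ℝ) x
          = ∑ n ∈ Finset.range (p.natDegree + 1), p.coeff n * Real.exp (-(n : ℝ) * x) := by
        intro x
        rw [Polynomial.aeval_eq_sum_range, BoundedContinuousFunction.sum_apply]
        refine Finset.sum_congr rfl fun n _ => ?_
        simp only [BoundedContinuousFunction.coe_smul, BoundedContinuousFunction.coe_pow,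
          Pi.pow_apply, expNegBCF_apply, smul_eq_mul, ← Real.exp_nat_mul]
        congr 2
        ring
      simp_rw [e]
      rw [integral_finsetSum]
      · simp_rw [integral_const_mul]
      · intro n _
        refine Integrable.const_mul ?_ _
        refine Integrable.of_bound (C := 1) (by fun_prop) (ae_of_all _ fun x => ?_)
        rw [Real.norm_eq_abs, Real.abs_exp, Real.exp_le_one_iff]
        have : (0 : ℝ) ≤ n * x := by positivity
        linarith
    change ∫ x, (Polynomial.aeval expNegBCF p : BoundedContinuousFunction ℝ≥0 ℝ) x ∂μ
      = ∫ x, (Polynomial.aeval expNegBCF p : BoundedContinuousFunction ℝ≥0 ℝ) x ∂ν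
    rw [key μ, key ν]
    simp_rw [h]

/-- The law of a nonnegative random variable is determined by its Laplace transform. -/
lemma identDistrib_of_laplace {Ω₁ Ω₂ : Type*} {m₁ : MeasurableSpace Ω₁} {m₂ : MeasurableSpace Ω₂}
    {P₁ : Measure Ω₁} {P₂ : Measure Ω₂} [IsProbabilityMeasure P₁] [IsProbabilityMeasure P₂]
    {U : Ω₁ → ℝ} {V : Ω₂ → ℝ} (hU : AEMeasurable U P₁) (hV : AEMeasurable V P₂)
    (hU0 : ∀ᵐ ω ∂P₁, 0 ≤ U ω) (hV0 : ∀ᵐ ω ∂P₂, 0 ≤ V ω)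
    (h : ∀ α : ℝ, 0 < α → ∫ ω, Real.exp (-α * U ω) ∂P₁ = ∫ ω, Real.exp (-α * V ω) ∂P₂) :
    IdentDistrib U V P₁ P₂ := by
  have hU' : AEMeasurable (fun ω => (U ω).toNNReal) P₁ := hU.real_toNNReal
  have hV' : AEMeasurable (fun ω => (V ω).toNNReal) P₂ := hV.real_toNNReal
  have hmap : P₁.map (fun ω => (U ω).toNNReal) = P₂.map (fun ω => (V ω).toNNReal) := by
    have := Measure.isProbabilityMeasure_map hU'
    have := Measure.isProbabilityMeasure_map hV'
    refine measure_nnreal_ext_of_laplace fun n => ?_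
    rw [integral_map hU' (by fun_prop), integral_map hV' (by fun_prop)]
    -- At `n = 0`, where `h` says nothing, both transforms equal the total mass one.
    rcases Nat.eq_zero_or_pos n with rfl | hn
    · simp
    · have e1 : ∫ ω, Real.exp (-(n : ℝ) * ((U ω).toNNReal : ℝ)) ∂P₁
          = ∫ ω, Real.exp (-(n : ℝ) * U ω) ∂P₁ :=
        integral_congr_ae (by filter_upwards [hU0] with ω hω; rw [Real.coe_toNNReal _ hω])
      have e2 : ∫ ω, Real.exp (-(n : ℝ) * ((V ω).toNNReal : ℝ)) ∂P₂
          = ∫ ω, Real.exp (-(n : ℝ) * V ω) ∂P₂ :=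
        integral_congr_ae (by filter_upwards [hV0] with ω hω; rw [Real.coe_toNNReal _ hω])
      rw [e1, e2]
      exact h n (by exact_mod_cast hn)
  have hid : IdentDistrib (fun ω => (U ω).toNNReal) (fun ω => (V ω).toNNReal) P₁ P₂ :=
    ⟨hU', hV', hmap⟩
  have h1 := hid.comp (u := fun x : ℝ≥0 => (x : ℝ)) measurable_coe_nnreal_real
  have a1 : ((fun x : ℝ≥0 => (x : ℝ)) ∘ fun ω => (U ω).toNNReal) =ᵐ[P₁] U := by
    filter_upwards [hU0] with ω hω using Real.coe_toNNReal _ hω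
  have a2 : ((fun x : ℝ≥0 => (x : ℝ)) ∘ fun ω => (V ω).toNNReal) =ᵐ[P₂] V := by
    filter_upwards [hV0] with ω hω using Real.coe_toNNReal _ hω
  exact ⟨hU, hV, by rw [← Measure.map_congr a1, ← Measure.map_congr a2]; exact h1.map_eq⟩

/-! ### Right derivative of a Laplace transform at zero. -/

section Derivative

variable {Ω : Type*} {m : MeasurableSpace Ω} {P : Measure Ω}

/-- Domination for differentiating under the expectation. The lower bound is the tangent line of
`exp`; the upper bound for negative `x` is convexity, `e^{α(-x)} ≤ (1 - α) + α e^{-x}`. -/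
lemma abs_exp_sub_one_div_le {α x : ℝ} (h0 : 0 < α) (h1 : α ≤ 1) :
    |(Real.exp (-α * x) - 1) / α| ≤ |x| + Real.exp (-x) := by
  have lower : -x ≤ (Real.exp (-α * x) - 1) / α := by
    rw [le_div_iff₀ h0]
    nlinarith [Real.add_one_le_exp (-α * x)]
  have upper : (Real.exp (-α * x) - 1) / α ≤ |x| + Real.exp (-x) := by
    rcases le_total 0 x with hx | hx
    · have : (Real.exp (-α * x) - 1) / α ≤ 0 :=
        div_nonpos_of_nonpos_of_nonneg
          (by have : Real.exp (-α * x) ≤ 1 := Real.exp_le_one_iff.2 (by nlinarith)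
              linarith) h0.le
      have := abs_nonneg x
      have := Real.exp_pos (-x)
      linarith
    · have hc := convexOn_exp.2 (mem_univ (0 : ℝ)) (mem_univ (-x)) (sub_nonneg.2 h1) h0.le
        (by ring)
      simp only [smul_eq_mul, mul_zero, zero_add, Real.exp_zero, mul_one] at hc
      rw [div_le_iff₀ h0]
      have e : -α * x = α * -x := by ring
      rw [e]
      have := abs_nonneg x
      nlinarith
  rw [abs_le]
  refine ⟨?_, upper⟩
  have := le_abs_self x
  have := Real.exp_pos (-x)
  linarith

lemma tendsto_exp_sub_one_div (x : ℝ) :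
    Tendsto (fun α : ℝ => (Real.exp (-α * x) - 1) / α) (𝓝[>] 0) (𝓝 (-x)) := by
  have h : HasDerivAt (fun α : ℝ => Real.exp (-α * x)) (-x) 0 := by
    have h1 : HasDerivAt (fun α : ℝ => -α * x) (-x) 0 := by
      simpa using ((hasDerivAt_id (0 : ℝ)).neg.mul_const x)
    simpa using h1.exp
  have := (hasDerivAt_iff_tendsto_slope.1 h).mono_left
    (nhdsWithin_mono 0 (fun y (hy : 0 < y) => hy.ne'))
  refine this.congr fun α => ?_
  simp [slope_def_field]

/-- Right derivative at zero of a Laplace transform. -/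
lemma tendsto_laplace_sub_one_div [IsProbabilityMeasure P] {X : Ω → ℝ} (hX : Integrable X P)
    (hexp : Integrable (fun ω => Real.exp (-X ω)) P) :
    Tendsto (fun α : ℝ => (∫ ω, Real.exp (-α * X ω) ∂P - 1) / α) (𝓝[>] 0)
      (𝓝 (-∫ ω, X ω ∂P)) := by
  have hmeas := hX.aestronglyMeasurable
  have hb : Integrable (fun ω => |X ω| + Real.exp (-X ω)) P := hX.abs.add hexp
  have hev : ∀ᶠ α : ℝ in 𝓝[>] 0, 0 < α ∧ α ≤ 1 := by
    filter_upwards [Ioc_mem_nhdsGT (zero_lt_one' ℝ)] with α hα using hα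
  have hm : ∀ α : ℝ, AEStronglyMeasurable (fun ω => (Real.exp (-α * X ω) - 1) / α) P :=
    fun α => by
      have : AEMeasurable X P := hmeas.aemeasurable
      exact AEMeasurable.aestronglyMeasurable (by fun_prop)
  have main : Tendsto (fun α : ℝ => ∫ ω, (Real.exp (-α * X ω) - 1) / α ∂P) (𝓝[>] 0)
      (𝓝 (∫ ω, -X ω ∂P)) := by
    refine tendsto_integral_filter_of_dominated_convergence _ (Eventually.of_forall hm) ?_ hb
      (ae_of_all _ fun ω => tendsto_exp_sub_one_div (X ω))
    filter_upwards [hev] with α hα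
    exact ae_of_all _ fun ω => abs_exp_sub_one_div_le hα.1 hα.2
  rw [integral_neg] at main
  refine main.congr' ?_
  filter_upwards [hev] with α hα
  have hint : Integrable (fun ω => (Real.exp (-α * X ω) - 1) / α) P :=
    hb.mono' (hm α) (ae_of_all _ fun ω => abs_exp_sub_one_div_le hα.1 hα.2)
  have hint' : Integrable (fun ω => Real.exp (-α * X ω)) P := by
    have := (hint.mul_const α).add (integrable_const (1 : ℝ))
    refine this.congr (ae_of_all _ fun ω => ?_)
    have := hα.1.ne'
    simp only [Pi.add_apply]
    field_simp
    ring
  rw [integral_div, integral_sub hint' (integrable_const _)]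
  simp

end Derivative

/-! ### Lindley's recursion for random walks with negative drift. -/

section RandomWalk

variable {Ω : Type*} {m : MeasurableSpace Ω} {P : Measure Ω}

/-- Variables that are adapted to an increasing sequence of σ-algebras, each being independent of
its past, are independent. -/
lemma iIndepFun_of_indep_past [IsProbabilityMeasure P] {𝓖 : ℕ → MeasurableSpace Ω}
    (hmono : Monotone 𝓖) {ξ : ℕ → Ω → ℝ}
    (hmeas : ∀ i, Measurable[𝓖 (i + 1)] (ξ i))
    (hind : ∀ i, Indep (MeasurableSpace.comap (ξ i) inferInstance) (𝓖 i) P) :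
    iIndepFun ξ P := by
  rw [iIndepFun_iff_measure_inter_preimage_eq_mul]
  intro s
  -- Peeling off the largest index leaves an event in the past of that index, from which the last
  -- variable is independent.
  induction s using Finset.induction_on_max with
  | empty => simp
  | insert a s hlt ih =>
    intro B hB
    have hnot : a ∉ s := fun h => lt_irrefl _ (hlt a h)
    rw [Finset.prod_insert hnot, ← ih fun i hi => hB i (Finset.mem_insert_of_mem hi)]
    rw [Finset.set_biInter_insert]
    refine (Indep_iff _ _ P).1 (hind a) _ _ ⟨B a, hB a (Finset.mem_insert_self _ _), rfl⟩ ?_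
    refine Finset.measurableSet_biInter s fun i hi => ?_
    exact hmono (Nat.succ_le_of_lt (hlt i hi)) _
      (hmeas i (hB i (Finset.mem_insert_of_mem hi)))

/-- The all-time supremum of the random walk with increments `x`. -/
noncomputable def walkSup (x : ℕ → ℝ) : ℝ := ⨆ n : ℕ, ∑ i ∈ Finset.range n, x i

lemma measurable_walkSup : Measurable walkSup :=
  Measurable.iSup fun n => by fun_prop

lemma bddAbove_walk_shift {x : ℕ → ℝ}
    (h : BddAbove (range fun n : ℕ => ∑ i ∈ Finset.range n, x i)) :
    BddAbove (range fun n : ℕ => ∑ i ∈ Finset.range n, x (i + 1)) := by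
  obtain ⟨C, hC⟩ := h
  refine ⟨C - x 0, ?_⟩
  rintro _ ⟨n, rfl⟩
  have := hC ⟨n + 1, rfl⟩
  simp only [Finset.sum_range_succ'] at this
  simp only
  linarith

lemma walkSup_nonneg {x : ℕ → ℝ}
    (h : BddAbove (range fun n : ℕ => ∑ i ∈ Finset.range n, x i)) : 0 ≤ walkSup x := by
  have := le_ciSup h 0
  rwa [Finset.sum_range_zero] at this

/-- Lindley's recursion: either the empty sum is the largest, or the first step is taken and the
supremum is that of the walk restarted after it. -/
lemma walkSup_eq_max {x : ℕ → ℝ}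
    (h : BddAbove (range fun n : ℕ => ∑ i ∈ Finset.range n, x i)) :
    walkSup x = max 0 (x 0 + walkSup fun i => x (i + 1)) := by
  have h' := bddAbove_walk_shift h
  apply le_antisymm
  · refine ciSup_le fun n => ?_
    rcases n with _ | n
    · simp
    · rw [Finset.sum_range_succ']
      refine le_max_of_le_right ?_
      rw [add_comm]
      exact add_le_add le_rfl (le_ciSup h' n)
  · refine max_le (walkSup_nonneg h) ?_
    rw [← le_sub_iff_add_le']
    refine ciSup_le fun n => ?_
    rw [le_sub_iff_add_le]
    have := le_ciSup h (n + 1)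
    rwa [Finset.sum_range_succ'] at this

/-- Independent identically distributed integrable increments with negative mean. -/
structure IsNegativeDriftWalk (ξ : ℕ → Ω → ℝ) (P : Measure Ω) : Prop where
  meas : ∀ i, Measurable (ξ i)
  indep : iIndepFun ξ P
  ident : ∀ i, IdentDistrib (ξ i) (ξ 0) P P
  integrable : Integrable (ξ 0) P
  neg : ∫ ω, ξ 0 ω ∂P < 0

namespace IsNegativeDriftWalk

variable {ξ : ℕ → Ω → ℝ}

/-- By the strong law the averages converge to a negative number, so the partial sums are eventually
nonpositive. -/
lemma ae_bddAbove (h : IsNegativeDriftWalk ξ P) :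
    ∀ᵐ ω ∂P, BddAbove (range fun n : ℕ => ∑ i ∈ Finset.range n, ξ i ω) := by
  have hlaw := strong_law_ae_real ξ h.integrable (fun i j hij => h.indep.indepFun hij) h.ident
  filter_upwards [hlaw] with ω hω
  have hev : ∀ᶠ n : ℕ in atTop, (∑ i ∈ Finset.range n, ξ i ω) ≤ 0 := by
    filter_upwards [hω.eventually (gt_mem_nhds h.neg), eventually_gt_atTop 0] with n hn hn0
    have hn0' : (0 : ℝ) < n := by exact_mod_cast hn0
    rw [div_lt_iff₀ hn0', zero_mul] at hn
    exact hn.le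
  exact (isBoundedUnder_of_eventually_le hev).bddAbove_range

lemma identDistrib_walkSup_shift [IsProbabilityMeasure P] (h : IsNegativeDriftWalk ξ P) :
    IdentDistrib (fun ω => walkSup fun i => ξ (i + 1) ω) (fun ω => walkSup fun i => ξ i ω) P P := by
  have hs : iIndepFun (fun i => ξ (i + 1)) P := h.indep.precomp (add_left_injective 1)
  have hm1 : Measurable fun ω i => ξ (i + 1) ω := measurable_pi_lambda _ fun i => h.meas (i + 1)
  have hm0 : Measurable fun ω i => ξ i ω := measurable_pi_lambda _ fun i => h.meas i
  have e : IdentDistrib (fun ω i => ξ (i + 1) ω) (fun ω i => ξ i ω) P P := by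
    refine ⟨hm1.aemeasurable, hm0.aemeasurable, ?_⟩
    rw [hs.map_fun_eq_infinitePi_map (fun i => h.meas (i + 1)),
      h.indep.map_fun_eq_infinitePi_map h.meas]
    congr 1
    funext i
    rw [(h.ident (i + 1)).map_eq, (h.ident i).map_eq]
  exact e.comp measurable_walkSup

lemma indepFun_walkSup_shift [IsProbabilityMeasure P] (h : IsNegativeDriftWalk ξ P) :
    IndepFun (ξ 0) (fun ω => walkSup fun i => ξ (i + 1) ω) P := by
  have hd : Disjoint ({0} : Set ℕ) (Ici 1) := by
    rw [Set.disjoint_singleton_left]; simp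
  have hI := indep_iSup_of_disjoint (fun i => (h.meas i).comap_le) h.indep hd
  refine indep_of_indep_of_le_left (indep_of_indep_of_le_right hI ?_) ?_
  · rw [← measurable_iff_comap_le]
    refine measurable_walkSup.comp (@measurable_pi_lambda _ _ _ (_) _ _ fun i => ?_)
    rw [measurable_iff_comap_le]
    exact le_iSup₂_of_le (i + 1) (by simp) le_rfl
  · exact le_iSup₂_of_le 0 (by simp) le_rfl

lemma ae_walkSup_shift_nonneg (h : IsNegativeDriftWalk ξ P) :
    ∀ᵐ ω ∂P, 0 ≤ walkSup fun i => ξ (i + 1) ω := by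
  filter_upwards [h.ae_bddAbove] with ω hω using walkSup_nonneg (bddAbove_walk_shift hω)

lemma measurable_walkSup_shift (h : IsNegativeDriftWalk ξ P) (j : ℕ) :
    Measurable fun ω => walkSup fun i => ξ (i + j) ω :=
  measurable_walkSup.comp (measurable_pi_lambda _ fun i => h.meas (i + j))

/-- Overshoot below zero in one step of the stationary Lindley recursion. -/
noncomputable def deficit (ξ : ℕ → Ω → ℝ) (ω : Ω) : ℝ :=
  max 0 (-(ξ 0 ω + walkSup fun i => ξ (i + 1) ω))

lemma measurable_deficit (h : IsNegativeDriftWalk ξ P) : Measurable (deficit ξ) :=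
  measurable_const.max ((h.meas 0).add (h.measurable_walkSup_shift 1)).neg

/-- With `y` the first step plus the restarted supremum, one of `y⁺`, `y⁻` vanishes, so `e^{αy⁻} +
e^{-αy⁺} = e^{-αy} + 1`; and `y⁺` is the supremum by Lindley's recursion. -/
lemma ae_exp_walkSup (h : IsNegativeDriftWalk ξ P) (α : ℝ) :
    ∀ᵐ ω ∂P, Real.exp (α * deficit ξ ω) =
      Real.exp (-α * ξ 0 ω) * Real.exp (-α * walkSup fun i => ξ (i + 1) ω)
        + 1 - Real.exp (-α * walkSup fun i => ξ i ω) := by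
  filter_upwards [h.ae_bddAbove] with ω hω
  rw [walkSup_eq_max hω, deficit, ← Real.exp_add, ← mul_add]
  set y := ξ 0 ω + walkSup fun i => ξ (i + 1) ω
  rcases le_total 0 y with hy | hy
  · rw [max_eq_left (by linarith), max_eq_right hy]; simp
  · rw [max_eq_right (by linarith), max_eq_left hy]; simp

lemma integrable_exp_walkSup [IsProbabilityMeasure P] (h : IsNegativeDriftWalk ξ P) {α : ℝ}
    (hα : 0 ≤ α) : Integrable (fun ω => Real.exp (-α * walkSup fun i => ξ i ω)) P := by
  refine Integrable.of_bound (C := 1) ?_ ?_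
  · have := h.measurable_walkSup_shift 0
    exact Measurable.aestronglyMeasurable (by fun_prop)
  · filter_upwards [h.ae_bddAbove] with ω hω
    rw [Real.norm_eq_abs, Real.abs_exp, Real.exp_le_one_iff]
    nlinarith [walkSup_nonneg hω]

lemma integrable_exp_mul [IsProbabilityMeasure P] (h : IsNegativeDriftWalk ξ P) {α : ℝ}
    (hα : 0 ≤ α) (hexp : Integrable (fun ω => Real.exp (-α * ξ 0 ω)) P) :
    Integrable (fun ω => Real.exp (-α * ξ 0 ω)
      * Real.exp (-α * walkSup fun i => ξ (i + 1) ω)) P := by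
  have hi : IndepFun (fun ω => Real.exp (-α * ξ 0 ω))
      (fun ω => Real.exp (-α * walkSup fun i => ξ (i + 1) ω)) P :=
    h.indepFun_walkSup_shift.comp (φ := fun x => Real.exp (-α * x))
      (ψ := fun x => Real.exp (-α * x)) (by fun_prop) (by fun_prop)
  refine hi.integrable_mul hexp ?_
  exact (h.identDistrib_walkSup_shift.comp (u := fun x => Real.exp (-α * x))
    (by fun_prop)).integrable_iff.2 (h.integrable_exp_walkSup hα)

lemma integrable_exp_deficit [IsProbabilityMeasure P] (h : IsNegativeDriftWalk ξ P) {α : ℝ}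
    (hα : 0 ≤ α) (hexp : Integrable (fun ω => Real.exp (-α * ξ 0 ω)) P) :
    Integrable (fun ω => Real.exp (α * deficit ξ ω)) P :=
  (((h.integrable_exp_mul hα hexp).add (integrable_const 1)).sub
    (h.integrable_exp_walkSup hα)).congr
    (by filter_upwards [h.ae_exp_walkSup α] with ω hω using hω.symm)

/-- Laplace transform of the Lindley recursion. -/
lemma laplace_walkSup [IsProbabilityMeasure P] (h : IsNegativeDriftWalk ξ P) {α : ℝ}
    (hα : 0 ≤ α) (hexp : Integrable (fun ω => Real.exp (-α * ξ 0 ω)) P) :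
    (∫ ω, Real.exp (-α * ξ 0 ω) ∂P - 1) * ∫ ω, Real.exp (-α * walkSup fun i => ξ i ω) ∂P
      = ∫ ω, Real.exp (α * deficit ξ ω) ∂P - 1 := by
  have hi : IndepFun (fun ω => Real.exp (-α * ξ 0 ω))
      (fun ω => Real.exp (-α * walkSup fun i => ξ (i + 1) ω)) P :=
    h.indepFun_walkSup_shift.comp (φ := fun x => Real.exp (-α * x))
      (ψ := fun x => Real.exp (-α * x)) (by fun_prop) (by fun_prop)
  have hid := (h.identDistrib_walkSup_shift.comp (u := fun x => Real.exp (-α * x))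
    (by fun_prop)).integral_eq
  simp only [Function.comp_def] at hid
  have hmul := hi.integral_fun_mul_eq_mul_integral hexp.aestronglyMeasurable
    (by have := h.measurable_walkSup_shift 1
        exact Measurable.aestronglyMeasurable (by fun_prop))
  rw [integral_congr_ae (h.ae_exp_walkSup α),
    integral_sub (f := fun ω => Real.exp (-α * ξ 0 ω)
      * Real.exp (-α * walkSup fun i => ξ (i + 1) ω) + 1) ((h.integrable_exp_mul hα hexp).add (integrable_const 1))
      (h.integrable_exp_walkSup hα),
    integral_add (h.integrable_exp_mul hα hexp) (integrable_const 1), hmul, hid]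
  simp only [integral_const, probReal_univ, smul_eq_mul, mul_one]
  ring

lemma deficit_nonneg (ω : Ω) : 0 ≤ deficit ξ ω := le_max_left _ _

lemma integrable_deficit (h : IsNegativeDriftWalk ξ P) : Integrable (deficit ξ) P := by
  refine h.integrable.abs.mono' h.measurable_deficit.aestronglyMeasurable ?_
  filter_upwards [h.ae_walkSup_shift_nonneg] with ω hω
  rw [Real.norm_eq_abs, abs_of_nonneg (deficit_nonneg ω)]
  refine max_le (abs_nonneg _) ?_
  have := neg_abs_le (ξ 0 ω)
  linarith

/-- The mean deficit compensates the drift. -/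
lemma integral_deficit [IsProbabilityMeasure P] (h : IsNegativeDriftWalk ξ P)
    (hexp : ∀ α : ℝ, 0 ≤ α → Integrable (fun ω => Real.exp (-α * ξ 0 ω)) P) :
    ∫ ω, deficit ξ ω ∂P = -∫ ω, ξ 0 ω ∂P := by
  -- `laplace_walkSup` is divided by `α` and `α ↓ 0`: the left side tends to minus the mean
  -- increment, since the transform of the finite supremum tends to one, and the right side to the
  -- mean deficit.
  have h1 := tendsto_laplace_sub_one_div h.integrable (by simpa using hexp 1 zero_le_one)
  have h2 := tendsto_laplace_sub_one_div (X := fun ω => -deficit ξ ω) h.integrable_deficit.neg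
    (by simpa using h.integrable_exp_deficit zero_le_one (hexp 1 zero_le_one))
  rw [integral_neg, neg_neg] at h2
  have h3 : Tendsto (fun α : ℝ => ∫ ω, Real.exp (-α * walkSup fun i => ξ i ω) ∂P) (𝓝[>] 0)
      (𝓝 1) := by
    have : Tendsto (fun α : ℝ => ∫ ω, Real.exp (-α * walkSup fun i => ξ i ω) ∂P) (𝓝[>] 0)
        (𝓝 (∫ _, (1 : ℝ) ∂P)) := by
      refine tendsto_integral_filter_of_dominated_convergence (fun _ => 1) ?_ ?_
        (integrable_const 1) ?_
      · refine Eventually.of_forall fun α => ?_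
        have := h.measurable_walkSup_shift 0
        exact Measurable.aestronglyMeasurable (by fun_prop)
      · filter_upwards [self_mem_nhdsWithin] with α hα
        filter_upwards [h.ae_bddAbove] with ω hω
        rw [Real.norm_eq_abs, Real.abs_exp, Real.exp_le_one_iff]
        have hα' : 0 < α := hα
        nlinarith [walkSup_nonneg hω]
      · refine ae_of_all _ fun ω => ?_
        have hc : Continuous fun α : ℝ => Real.exp (-α * walkSup fun i => ξ i ω) := by fun_prop
        have := (hc.tendsto 0).mono_left (nhdsWithin_le_nhds (s := Ioi 0))
        simpa using this
    simpa using this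
  have h4 := h1.mul h3
  rw [mul_one] at h4
  refine tendsto_nhds_unique h2 (h4.congr' ?_)
  filter_upwards [self_mem_nhdsWithin] with α hα
  have hα' : (0 : ℝ) < α := hα
  have := h.laplace_walkSup hα'.le (hexp α hα'.le)
  simp only [neg_mul_neg]
  rw [← this]
  ring

end IsNegativeDriftWalk

end RandomWalk

/-! ### The quadratic remainder of the deficit is negligible. -/

section Negligible

lemma sq_mul_exp_half_le {y : ℝ} (hy : 0 ≤ y) :
    y ^ 2 * Real.exp (y / 2) ≤ 2 * Real.exp (2 * y) := by
  have h1 := Real.pow_div_factorial_le_exp y hy 2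
  have h2 : Real.exp (y / 2) ≤ Real.exp y := Real.exp_le_exp.2 (by linarith)
  have e : Real.exp (2 * y) = Real.exp y * Real.exp y := by rw [← Real.exp_add]; ring_nf
  have h3 := Real.exp_pos (y / 2)
  norm_num [Nat.factorial] at h1
  rw [e]
  have := mul_le_mul h1 h2 h3.le (Real.exp_pos y).le
  linarith

lemma cube_mul_exp_le {y : ℝ} (hy : 0 ≤ y) :
    y ^ 3 * Real.exp y ≤ 6 * Real.exp (2 * y) := by
  have h1 := Real.pow_div_factorial_le_exp y hy 3
  have e : Real.exp (2 * y) = Real.exp y * Real.exp y := by rw [← Real.exp_add]; ring_nf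
  norm_num [Nat.factorial] at h1
  rw [e]
  have := mul_le_mul_of_nonneg_right h1 (Real.exp_pos y).le
  linarith

lemma cube_mul_exp_half_le {y : ℝ} (hy : 0 ≤ y) :
    y ^ 3 * Real.exp (y / 2) ≤ 6 * Real.exp (2 * y) :=
  (mul_le_mul_of_nonneg_left (Real.exp_le_exp.2 (by linarith)) (by positivity)).trans
    (cube_mul_exp_le hy)

/-- The left side is the geometric mean of `y` and `y³ e^y`; weighting the two by `1/l` and `l`
interpolates between a small mean and a bounded exponential moment. -/
lemma sq_mul_exp_half_le_interpolation {y l : ℝ} (hy : 0 ≤ y) (hl : 0 < l) :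
    y ^ 2 * Real.exp (y / 2) ≤ y / l + 6 * l * Real.exp (2 * y) := by
  have h1 : y ^ 2 * Real.exp (y / 2) ≤ y / l + l * (y ^ 3 * Real.exp y) := by
    have e : Real.exp y = Real.exp (y / 2) ^ 2 := by rw [← Real.exp_nat_mul]; ring_nf
    set z := Real.exp (y / 2)
    rw [e]
    have : 0 ≤ y / l * ((1 - l * y * z) ^ 2 + l * y * z) := by
      have : 0 < z := Real.exp_pos _
      positivity
    have e2 : y / l * ((1 - l * y * z) ^ 2 + l * y * z)
        = y / l + l * (y ^ 3 * z ^ 2) - y ^ 2 * z := by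
      field_simp
      ring
    linarith
  nlinarith [cube_mul_exp_le hy]

lemma exp_sub_one_sub_le {y : ℝ} (hy : 0 ≤ y) :
    Real.exp y - 1 - y ≤ y ^ 2 * Real.exp y := by
  have h1 : 1 - y ≤ Real.exp (-y) := by linarith [Real.add_one_le_exp (-y)]
  have h2 : Real.exp (-y) * Real.exp y = 1 := by rw [← Real.exp_add]; simp
  have h3 := Real.exp_pos y
  have h4 : Real.exp y - 1 ≤ y * Real.exp y := by nlinarith
  nlinarith

variable {Ω : Type*} {m : MeasurableSpace Ω} {P : Measure Ω}

/-- Pointwise bound of the quadratic remainder of the deficit `d = (x + w)⁻` in terms of the scaled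
negative part of `x`. -/
lemma sq_exp_deficit_le {α r x w : ℝ} (hr : 0 < r) (hαr : α * r ≤ 1 / 2)
    (hw : 0 ≤ w) :
    max 0 (-(x + w)) ^ 2 * Real.exp (α * max 0 (-(x + w)))
      ≤ r ^ 2 * ((max 0 (-x) / r) ^ 2 * Real.exp (max 0 (-x) / r / 2)) := by
  have hd : max 0 (-(x + w)) ≤ max 0 (-x) := max_le_max le_rfl (by linarith)
  have hd0 : 0 ≤ max 0 (-(x + w)) := le_max_left _ _
  have e : r ^ 2 * ((max 0 (-x) / r) ^ 2 * Real.exp (max 0 (-x) / r / 2))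
      = max 0 (-x) ^ 2 * Real.exp (max 0 (-x) / r / 2) := by
    field_simp
  rw [e]
  have hexp : α * max 0 (-(x + w)) ≤ max 0 (-x) / r / 2 := by
    have h1 : α ≤ 1 / 2 / r := by rwa [le_div_iff₀ hr]
    calc α * max 0 (-(x + w)) ≤ 1 / 2 / r * max 0 (-x) :=
          mul_le_mul h1 hd hd0 (by positivity)
      _ = _ := by ring
  gcongr

/-- Below the threshold the indicator is kept, so that independence can turn it into a small
probability. Above it, a positive deficit forces `x⁻ ≥ δ`, so the factor `(r/δ)(x⁻/r) ≥ 1` may be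
inserted, which gains a power of `r`. -/
lemma sq_exp_deficit_le_of_threshold {α r x w δ : ℝ} (hr : 0 < r)
    (hαr : α * r ≤ 1 / 2) (hw : 0 ≤ w) (hδ : 0 < δ) :
    max 0 (-(x + w)) ^ 2 * Real.exp (α * max 0 (-(x + w)))
      ≤ r ^ 2 * (2 * (Real.exp (2 * (max 0 (-x) / r)) * (Iio δ).indicator 1 w)
          + 6 * r / δ * Real.exp (2 * (max 0 (-x) / r))) := by
  have hb := sq_exp_deficit_le (x := x) hr hαr hw
  set y := max 0 (-x) / r with hy
  have hy0 : 0 ≤ y := div_nonneg (le_max_left _ _) hr.le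
  have hexp := Real.exp_pos (2 * y)
  by_cases hwδ : w < δ
  · rw [indicator_of_mem (show w ∈ Iio δ from hwδ)]
    refine hb.trans (mul_le_mul_of_nonneg_left ?_ (by positivity))
    have := sq_mul_exp_half_le hy0
    have h2 : 0 ≤ 6 * r / δ * Real.exp (2 * y) := by positivity
    simp only [Pi.one_apply, mul_one]
    linarith
  · rw [indicator_of_notMem (show w ∉ Iio δ from hwδ), mul_zero, mul_zero, zero_add]
    push Not at hwδ
    rcases le_total 0 (x + w) with hxw | hxw
    · rw [max_eq_left (by linarith)]
      simp only [ne_eq, OfNat.ofNat_ne_zero, not_false_eq_true, zero_pow, zero_mul]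
      positivity
    · refine hb.trans (mul_le_mul_of_nonneg_left ?_ (by positivity))
      have h1 : δ ≤ r * y := by
        rw [hy, mul_div_cancel₀ _ hr.ne']
        exact le_max_of_le_right (by linarith)
      have h2 : 1 ≤ r / δ * y := by
        rw [div_mul_eq_mul_div, le_div_iff₀ hδ]; linarith
      have h3 := cube_mul_exp_half_le hy0
      calc y ^ 2 * Real.exp (y / 2) ≤ (r / δ * y) * (y ^ 2 * Real.exp (y / 2)) :=
            le_mul_of_one_le_left (by positivity) h2
        _ = r / δ * (y ^ 3 * Real.exp (y / 2)) := by ring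
        _ ≤ r / δ * (6 * Real.exp (2 * y)) := by gcongr
        _ = _ := by ring

lemma integrable_negPart_div [IsProbabilityMeasure P] {x : Ω → ℝ} {r : ℝ} (hr : 0 < r)
    (hx : Measurable x)
    (hK : Integrable (fun ω => Real.exp (2 * (max 0 (-x ω) / r))) P) :
    Integrable (fun ω => max 0 (-x ω) / r) P := by
  refine hK.mono' (Measurable.aestronglyMeasurable (by fun_prop)) (ae_of_all _ fun ω => ?_)
  have h0 : 0 ≤ max 0 (-x ω) / r := div_nonneg (le_max_left _ _) hr.le
  rw [Real.norm_eq_abs, abs_of_nonneg h0]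
  have := Real.add_one_le_exp (2 * (max 0 (-x ω) / r))
  linarith

/-- If the level `w` is below every `δ > 0` with probability more than `ε`, then the mean deficit
controls the mean negative part of the increment. -/
lemma mul_integral_negPart_le [IsProbabilityMeasure P] {x w : Ω → ℝ} (hx : Measurable x)
    (hw : Measurable w) (hind : IndepFun x w P) (hint : Integrable (fun ω => max 0 (-x ω)) P)
    (hD : Integrable (fun ω => max 0 (-(x ω + w ω))) P) {ε : ℝ}
    (hε : 0 < ε) (hlow : ∀ δ : ℝ, 0 < δ → ε ≤ P.real {ω | w ω < δ}) :
    ε * ∫ ω, max 0 (-x ω) ∂P ≤ ∫ ω, max 0 (-(x ω + w ω)) ∂P := by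
  -- On `{w < δ}` the deficit is at least `(x⁻ - δ)⁺`, and independence factors out the probability
  -- of that event. Then `δ ↓ 0`.
  have key : ∀ δ : ℝ, 0 < δ →
      ε * (∫ ω, max 0 (-x ω) ∂P - δ) ≤ ∫ ω, max 0 (-(x ω + w ω)) ∂P := by
    intro δ hδ
    have hf : Integrable (fun ω => max 0 (max 0 (-x ω) - δ)) P := by
      refine hint.mono' (Measurable.aestronglyMeasurable (by fun_prop)) (ae_of_all _ fun ω => ?_)
      rw [Real.norm_eq_abs, abs_of_nonneg (le_max_left _ _)]
      exact max_le (le_max_left _ _) (by linarith)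
    have hind' : IndepFun (fun ω => max 0 (max 0 (-x ω) - δ))
        (fun ω => (Iio δ).indicator (1 : ℝ → ℝ) (w ω)) P :=
      hind.comp (φ := fun a : ℝ => max 0 (max 0 (-a) - δ)) (ψ := (Iio δ).indicator (1 : ℝ → ℝ))
        (by fun_prop) (measurable_one.indicator measurableSet_Iio)
    have hmi : Measurable fun ω => (Iio δ).indicator (1 : ℝ → ℝ) (w ω) :=
      (measurable_one.indicator measurableSet_Iio).comp hw
    have hpr := hind'.integral_fun_mul_eq_mul_integral hf.aestronglyMeasurable
      hmi.aestronglyMeasurable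
    have hind1 : ∫ ω, (Iio δ).indicator (1 : ℝ → ℝ) (w ω) ∂P = P.real {ω | w ω < δ} := by
      have : (fun ω => (Iio δ).indicator (1 : ℝ → ℝ) (w ω)) = {ω | w ω < δ}.indicator 1 := by
        ext ω; simp [indicator]
      rw [this, integral_indicator_one (measurableSet_lt hw measurable_const)]
    have h1 : ∫ ω, max 0 (-x ω) ∂P - δ ≤ ∫ ω, max 0 (max 0 (-x ω) - δ) ∂P := by
      have : ∫ ω, (max 0 (-x ω) - δ) ∂P = ∫ ω, max 0 (-x ω) ∂P - δ := by
        rw [integral_sub hint (integrable_const _)]; simp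
      rw [← this]
      exact integral_mono (hint.sub (integrable_const _)) hf fun ω => le_max_right _ _
    have h2 : ∫ ω, max 0 (max 0 (-x ω) - δ) * (Iio δ).indicator (1 : ℝ → ℝ) (w ω) ∂P
        ≤ ∫ ω, max 0 (-(x ω + w ω)) ∂P := by
      refine integral_mono_of_nonneg (ae_of_all _ fun ω => ?_) hD (ae_of_all _ fun ω => ?_)
      · exact mul_nonneg (le_max_left _ _) (indicator_nonneg (by simp) _)
      · by_cases h : w ω < δ
        · simp only [indicator_of_mem (show w ω ∈ Iio δ from h), Pi.one_apply, mul_one]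
          refine max_le (le_max_left _ _) ?_
          rcases le_total 0 (x ω) with hx0 | hx0
          · rw [max_eq_left (by linarith)]
            exact le_max_of_le_left (by linarith)
          · rw [max_eq_right (by linarith)]
            exact le_max_of_le_right (by linarith)
        · simp only [indicator_of_notMem (show w ω ∉ Iio δ from h), mul_zero]
          exact le_max_left _ _
    rw [hpr, hind1] at h2
    have h3 : 0 ≤ ∫ ω, max 0 (max 0 (-x ω) - δ) ∂P := integral_nonneg fun ω => le_max_left _ _
    nlinarith [hlow δ hδ]
  have hlim : Tendsto (fun δ : ℝ => ε * (∫ ω, max 0 (-x ω) ∂P - δ)) (𝓝[>] 0)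
      (𝓝 (ε * ∫ ω, max 0 (-x ω) ∂P)) := by
    have hc : Continuous fun δ : ℝ => ε * (∫ ω, max 0 (-x ω) ∂P - δ) := by fun_prop
    have := (hc.tendsto 0).mono_left (nhdsWithin_le_nhds (s := Ioi 0))
    simpa using this
  refine le_of_tendsto hlim ?_
  filter_upwards [self_mem_nhdsWithin] with δ hδ using key δ hδ

/-- Negligibility of the quadratic remainder of the deficit on a mesh tending to zero. -/
lemma tendsto_integral_sq_exp_deficit [IsProbabilityMeasure P] {r : ℕ → ℝ} (hr : ∀ k, 0 < r k)
    (hr0 : Tendsto r atTop (𝓝 0)) {x w : ℕ → Ω → ℝ} (hx : ∀ k, Measurable (x k))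
    (hw : ∀ k, Measurable (w k)) (hind : ∀ k, IndepFun (x k) (w k) P)
    (hw0 : ∀ k, ∀ᵐ ω ∂P, 0 ≤ w k ω) {K a : ℝ}
    (hK : ∀ k, Integrable (fun ω => Real.exp (2 * (max 0 (-x k ω) / r k))) P)
    (hK' : ∀ k, ∫ ω, Real.exp (2 * (max 0 (-x k ω) / r k)) ∂P ≤ K)
    (hD : ∀ k, Integrable (fun ω => max 0 (-(x k ω + w k ω))) P)
    (hDa : ∀ k, ∫ ω, max 0 (-(x k ω + w k ω)) ∂P ≤ a * r k ^ 2)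
    (hanti : ∀ δ : ℝ, Antitone fun k => P.real {ω | w k ω < δ}) (α : ℝ) :
    Tendsto (fun k => (∫ ω, max 0 (-(x k ω + w k ω)) ^ 2
      * Real.exp (α * max 0 (-(x k ω + w k ω))) ∂P) / r k ^ 2) atTop (𝓝 0) := by
  have hK0 : 0 ≤ K := (integral_nonneg fun ω => (Real.exp_pos _).le).trans (hK' 0)
  have hsmall : ∀ᶠ k in atTop, α * r k ≤ 1 / 2 := by
    have : Tendsto (fun k => α * r k) atTop (𝓝 0) := by simpa using hr0.const_mul α
    filter_upwards [this.eventually (gt_mem_nhds (show (0 : ℝ) < 1 / 2 by norm_num))] with k hk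
      using hk.le
  have hnn : ∀ k, 0 ≤ (∫ ω, max 0 (-(x k ω + w k ω)) ^ 2
      * Real.exp (α * max 0 (-(x k ω + w k ω))) ∂P) / r k ^ 2 := fun k =>
    div_nonneg (integral_nonneg fun ω => by positivity) (sq_nonneg _)
  suffices H : ∀ ε : ℝ, 0 < ε → ∀ᶠ k in atTop, (∫ ω, max 0 (-(x k ω + w k ω)) ^ 2
      * Real.exp (α * max 0 (-(x k ω + w k ω))) ∂P) / r k ^ 2 ≤ (6 * K + 1) * ε by
    rw [Metric.tendsto_nhds]
    intro e he
    filter_upwards [H (e / (2 * (6 * K + 1))) (by positivity)] with k hk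
    rw [Real.dist_eq, sub_zero, abs_of_nonneg (hnn k)]
    refine hk.trans_lt ?_
    have : (6 * K + 1) * (e / (2 * (6 * K + 1))) = e / 2 := by field_simp
    linarith
  -- The dichotomy: either the levels put little mass near zero, or uniformly in `k` they keep mass
  -- above a fixed `ε₀` below every positive threshold.
  by_cases hcase : ∀ ε : ℝ, 0 < ε → ∃ δ : ℝ, 0 < δ ∧ ∃ k, P.real {ω | w k ω < δ} ≤ ε
  · intro ε hε
    obtain ⟨δ, hδ, k₀, hk₀⟩ := hcase ε hε
    have hr' : ∀ᶠ k in atTop, 6 * r k / δ * K ≤ ε := by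
      have : Tendsto (fun k => 6 * r k / δ * K) atTop (𝓝 0) := by
        simpa using ((hr0.const_mul 6).div_const δ).mul_const K
      filter_upwards [this.eventually (gt_mem_nhds hε)] with k hk using hk.le
    filter_upwards [hsmall, hr', eventually_ge_atTop k₀] with k hk hk2 hk3
    rw [div_le_iff₀ (pow_pos (hr k) 2)]
    have hmi : Measurable fun ω => (Iio δ).indicator (1 : ℝ → ℝ) (w k ω) :=
      (measurable_one.indicator measurableSet_Iio).comp (hw k)
    have hind' : IndepFun (fun ω => Real.exp (2 * (max 0 (-x k ω) / r k)))
        (fun ω => (Iio δ).indicator (1 : ℝ → ℝ) (w k ω)) P :=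
      (hind k).comp (φ := fun a : ℝ => Real.exp (2 * (max 0 (-a) / r k)))
        (ψ := (Iio δ).indicator (1 : ℝ → ℝ))
        (by fun_prop) (measurable_one.indicator measurableSet_Iio)
    have hint1 : Integrable (fun ω => (Iio δ).indicator (1 : ℝ → ℝ) (w k ω)) P := by
      refine Integrable.of_bound (C := 1) hmi.aestronglyMeasurable (ae_of_all _ fun ω => ?_)
      unfold indicator
      split_ifs <;> simp
    have hpr := hind'.integral_fun_mul_eq_mul_integral (hK k).aestronglyMeasurable
      hmi.aestronglyMeasurable
    have hi2 : Integrable (fun ω => Real.exp (2 * (max 0 (-x k ω) / r k))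
        * (Iio δ).indicator (1 : ℝ → ℝ) (w k ω)) P := hind'.integrable_mul (hK k) hint1
    have hind1 : ∫ ω, (Iio δ).indicator (1 : ℝ → ℝ) (w k ω) ∂P = P.real {ω | w k ω < δ} := by
      have : (fun ω => (Iio δ).indicator (1 : ℝ → ℝ) (w k ω)) = {ω | w k ω < δ}.indicator 1 := by
        ext ω; simp [indicator]
      rw [this, integral_indicator_one (measurableSet_lt (hw k) measurable_const)]
    rw [hind1] at hpr
    -- Antitonicity in `k` carries the estimate from the single index `k₀` to all later ones.
    have hp : P.real {ω | w k ω < δ} ≤ ε := (hanti δ hk3).trans hk₀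
    have hle : ∫ ω, max 0 (-(x k ω + w k ω)) ^ 2
          * Real.exp (α * max 0 (-(x k ω + w k ω))) ∂P
        ≤ ∫ ω, r k ^ 2 * (2 * (Real.exp (2 * (max 0 (-x k ω) / r k))
            * (Iio δ).indicator (1 : ℝ → ℝ) (w k ω))
          + 6 * r k / δ * Real.exp (2 * (max 0 (-x k ω) / r k))) ∂P := by
      refine integral_mono_of_nonneg (ae_of_all _ fun ω => by positivity)
        (((hi2.const_mul 2).add ((hK k).const_mul _)).const_mul _) ?_
      filter_upwards [hw0 k] with ω hω
      exact sq_exp_deficit_le_of_threshold (hr k) hk hω hδ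
    refine hle.trans ?_
    rw [integral_const_mul, integral_add (hi2.const_mul 2) ((hK k).const_mul _),
      integral_const_mul, integral_const_mul, hpr, mul_comm]
    refine mul_le_mul_of_nonneg_right ?_ (sq_nonneg _)
    have h1 : (∫ ω, Real.exp (2 * (max 0 (-x k ω) / r k)) ∂P) * P.real {ω | w k ω < δ} ≤ K * ε :=
      mul_le_mul (hK' k) hp measureReal_nonneg hK0
    have h2 : 6 * r k / δ * ∫ ω, Real.exp (2 * (max 0 (-x k ω) / r k)) ∂P
        ≤ 6 * r k / δ * K :=
      mul_le_mul_of_nonneg_left (hK' k) (div_nonneg (by have := hr k; positivity) hδ.le)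
    nlinarith [mul_nonneg hK0 hε.le]
  · push Not at hcase
    obtain ⟨ε₀, hε₀, hlow⟩ := hcase
    intro ε hε
    -- `a r/ε₀` will bound the mean of the scaled negative part: the mean deficit is at most `a r²`
    -- and at least `ε₀` times the mean negative part. The interpolation is then used with weight `l
    -- = ε`.
    have hr' : ∀ᶠ k in atTop, a * r k / ε₀ / ε ≤ ε := by
      have : Tendsto (fun k => a * r k / ε₀ / ε) atTop (𝓝 0) := by
        simpa using ((hr0.const_mul a).div_const ε₀).div_const ε
      filter_upwards [this.eventually (gt_mem_nhds hε)] with k hk using hk.le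
    filter_upwards [hsmall, hr'] with k hk hk2
    rw [div_le_iff₀ (pow_pos (hr k) 2)]
    have hY := integrable_negPart_div (hr k) (hx k) (hK k)
    have hneg : Integrable (fun ω => max 0 (-x k ω)) P := by
      refine (hY.mul_const (r k)).congr (ae_of_all _ fun ω => ?_)
      exact div_mul_cancel₀ _ (hr k).ne'
    have hm := mul_integral_negPart_le (hx k) (hw k) (hind k) hneg (hD k) hε₀
      fun δ hδ => (hlow δ hδ k).le
    have hEY : ∫ ω, max 0 (-x k ω) / r k ∂P ≤ a * r k / ε₀ := by
      rw [integral_div, div_le_iff₀ (hr k), div_mul_eq_mul_div, le_div_iff₀ hε₀]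
      have := hm.trans (hDa k)
      linarith
    have hle : ∫ ω, max 0 (-(x k ω + w k ω)) ^ 2
          * Real.exp (α * max 0 (-(x k ω + w k ω))) ∂P
        ≤ ∫ ω, r k ^ 2 * (max 0 (-x k ω) / r k / ε
            + 6 * ε * Real.exp (2 * (max 0 (-x k ω) / r k))) ∂P := by
      refine integral_mono_of_nonneg (ae_of_all _ fun ω => by positivity)
        (((hY.div_const ε).add ((hK k).const_mul _)).const_mul _) ?_
      filter_upwards [hw0 k] with ω hω
      refine (sq_exp_deficit_le (hr k) hk hω).trans
        (mul_le_mul_of_nonneg_left ?_ (sq_nonneg _))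
      exact sq_mul_exp_half_le_interpolation (div_nonneg (le_max_left _ _) (hr k).le) hε
    refine hle.trans ?_
    rw [integral_const_mul, integral_add (hY.div_const ε) ((hK k).const_mul _),
      integral_const_mul, integral_div, mul_comm]
    refine mul_le_mul_of_nonneg_right ?_ (sq_nonneg _)
    have h1 : (∫ ω, max 0 (-x k ω) / r k ∂P) / ε ≤ a * r k / ε₀ / ε := by gcongr
    have h2 : 6 * ε * ∫ ω, Real.exp (2 * (max 0 (-x k ω) / r k)) ∂P ≤ 6 * ε * K :=
      mul_le_mul_of_nonneg_left (hK' k) (by positivity)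
    linarith

end Negligible

/-! ### Mean, positivity and quadratic growth of Laplace exponents. -/

section LaplaceExponent

variable {Ω : Type*} {m : MeasurableSpace Ω} {P : Measure Ω}

/-- Without integrability the Bochner integral would be `0`, which is no value of `exp`. -/
lemma HasLaplaceExponent.integrable_exp {X : ℝ≥0 → Ω → ℝ} {ψ : ℝ → ℝ}
    (h : HasLaplaceExponent X ψ P) {α : ℝ} (hα : 0 ≤ α) (t : ℝ≥0) :
    Integrable (fun ω => Real.exp (-α * X t ω)) P := by
  by_contra hn
  have := h α hα t
  rw [integral_undef hn] at this
  exact (Real.exp_pos _).ne this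

/-- The logarithm of a Laplace transform has right derivative `-E Y` at zero. -/
lemma hasDerivWithinAt_log_laplace [IsProbabilityMeasure P] {Y : Ω → ℝ} {ψ : ℝ → ℝ}
    (hY : Integrable Y P)
    (hψ : ∀ α : ℝ, 0 ≤ α → ∫ ω, Real.exp (-α * Y ω) ∂P = Real.exp (ψ α)) :
    HasDerivWithinAt ψ (-∫ ω, Y ω ∂P) (Ici 0) 0 := by
  have hexp : Integrable (fun ω => Real.exp (-Y ω)) P := by
    by_contra hn
    have := hψ 1 zero_le_one
    simp only [neg_mul, one_mul] at this
    rw [integral_undef hn] at this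
    exact (Real.exp_pos _).ne this
  have hg : HasDerivWithinAt (fun α : ℝ => ∫ ω, Real.exp (-α * Y ω) ∂P) (-∫ ω, Y ω ∂P)
      (Ici 0) 0 := by
    rw [← hasDerivWithinAt_Ioi_iff_Ici, hasDerivWithinAt_iff_tendsto_slope' (by simp)]
    refine (tendsto_laplace_sub_one_div hY hexp).congr fun α => ?_
    simp [slope_def_field]
  have hlog := hg.log (by simp)
  simp only [neg_zero, zero_mul, Real.exp_zero, integral_const, probReal_univ, smul_eq_mul,
    mul_one, div_one] at hlog
  refine hlog.congr (fun α hα => ?_) ?_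
  · rw [hψ α hα, Real.log_exp]
  · rw [hψ 0 le_rfl, Real.log_exp]

lemma HasLaplaceExponent.hasDerivWithinAt [IsProbabilityMeasure P] {X : ℝ≥0 → Ω → ℝ} {ψ : ℝ → ℝ}
    (h : HasLaplaceExponent X ψ P) {t : ℝ≥0} (hX : Integrable (X t) P) :
    HasDerivWithinAt (fun α => t * ψ α) (-∫ ω, X t ω ∂P) (Ici 0) 0 :=
  hasDerivWithinAt_log_laplace hX fun α hα => h α hα t

lemma HasLaplaceExponent.hasDerivWithinAt_zero [IsProbabilityMeasure P] {X : ℝ≥0 → Ω → ℝ}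
    {ψ : ℝ → ℝ} (h : HasLaplaceExponent X ψ P) (hX : Integrable (X 1) P) :
    HasDerivWithinAt ψ (-∫ ω, X 1 ω ∂P) (Ici 0) 0 := by
  simpa using h.hasDerivWithinAt hX

/-- Linearity of the mean in time follows from uniqueness of the right derivative of `t ψ` at zero.
-/
lemma HasLaplaceExponent.integral_eq_mul [IsProbabilityMeasure P] {X : ℝ≥0 → Ω → ℝ} {ψ : ℝ → ℝ}
    (h : HasLaplaceExponent X ψ P) (hX : Integrable (X 1) P) {t : ℝ≥0} (ht : Integrable (X t) P) :
    ∫ ω, X t ω ∂P = t * ∫ ω, X 1 ω ∂P := by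
  have h1 := (h.hasDerivWithinAt_zero hX).const_mul (t : ℝ)
  have h2 := h.hasDerivWithinAt ht
  have := (uniqueDiffWithinAt_Ici (0 : ℝ)).eq_deriv _ h1 h2
  linarith

lemma HasLaplaceExponent.apply_zero [IsProbabilityMeasure P] {X : ℝ≥0 → Ω → ℝ} {ψ : ℝ → ℝ}
    (h : HasLaplaceExponent X ψ P) : ψ 0 = 0 := by
  have := h 0 le_rfl 1
  simpa using this.symm

/-- The tangent-line bound `1 + x ≤ e^x` is integrated; for a negative mean this makes the exponent
positive. -/
lemma HasLaplaceExponent.le_apply [IsProbabilityMeasure P] {X : ℝ≥0 → Ω → ℝ} {ψ : ℝ → ℝ}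
    (h : HasLaplaceExponent X ψ P) (hX : Integrable (X 1) P) {α : ℝ} (hα : 0 ≤ α) :
    1 - α * ∫ ω, X 1 ω ∂P ≤ Real.exp (ψ α) := by
  have h1 := h α hα 1
  simp only [NNReal.coe_one, one_mul] at h1
  rw [← h1]
  have h2 : ∫ ω, (1 - α * X 1 ω) ∂P = 1 - α * ∫ ω, X 1 ω ∂P := by
    rw [integral_sub (integrable_const _) (hX.const_mul α), integral_const_mul]; simp
  rw [← h2]
  refine integral_mono ((integrable_const _).sub (hX.const_mul α)) (h.integrable_exp hα 1)
    fun ω => ?_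
  have := Real.add_one_le_exp (-α * X 1 ω)
  simp only
  linarith

lemma HasLaplaceExponent.pos [IsProbabilityMeasure P] {X : ℝ≥0 → Ω → ℝ} {ψ : ℝ → ℝ}
    (h : HasLaplaceExponent X ψ P) (hX : Integrable (X 1) P) (hneg : ∫ ω, X 1 ω ∂P < 0)
    {α : ℝ} (hα : 0 < α) : 0 < ψ α := by
  rw [← Real.one_lt_exp_iff]
  refine lt_of_lt_of_le ?_ (h.le_apply hX hα.le)
  nlinarith

lemma exp_neg_le_quadratic {y : ℝ} (hy : 0 ≤ y) : Real.exp (-y) ≤ 1 - y + y ^ 2 := by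
  rw [Real.exp_neg, inv_le_iff_one_le_mul₀ (Real.exp_pos y)]
  have h1 := Real.add_one_le_exp y
  have h2 : 0 ≤ 1 - y + y ^ 2 := by nlinarith [sq_nonneg (y - 1)]
  nlinarith [mul_le_mul_of_nonneg_left h1 h2, pow_nonneg hy 3]

/-- Quadratic growth of the exponent of a process without negative jumps. -/
lemma exists_upExponent_le {c σ : ℝ} {ν : Measure ℝ} (hν : IsLevyMeasure ν) :
    ∃ C : ℝ, ∀ α : ℝ, 1 ≤ α → upExponent c σ ν α ≤ C * α ^ 2 := by
  have hint : Integrable (fun x : ℝ => min 1 (x ^ 2)) (ν.restrict (Ioi 0)) := by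
    refine Integrable.restrict ⟨by fun_prop, ?_⟩
    rw [hasFiniteIntegral_iff_ofReal (ae_of_all _ fun x => by positivity)]
    exact hν.2
  refine ⟨|c| + σ ^ 2 / 2 + ∫ x in Ioi 0, min 1 (x ^ 2) ∂ν, fun α hα => ?_⟩
  have hα2 : α ≤ α ^ 2 := by nlinarith
  have hI : 0 ≤ ∫ x in Ioi 0, min 1 (x ^ 2) ∂ν := integral_nonneg fun x => by positivity
  have h1 : ∫ x in Ioi 0, (Real.exp (-α * x) - 1 + α * x * (Iic (1 : ℝ)).indicator 1 x) ∂ν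
      ≤ α ^ 2 * ∫ x in Ioi 0, min 1 (x ^ 2) ∂ν := by
    -- If the integrand is not integrable, its integral is `0` by convention and the bound is
    -- trivial.
    by_cases hi : Integrable
        (fun x => Real.exp (-α * x) - 1 + α * x * (Iic (1 : ℝ)).indicator 1 x) (ν.restrict (Ioi 0))
    · rw [← integral_const_mul]
      refine integral_mono_ae hi (hint.const_mul _) ?_
      filter_upwards [ae_restrict_mem measurableSet_Ioi] with x hx
      have hx0 : 0 < x := hx
      have hαx : 0 ≤ α * x := by positivity
      by_cases hx1 : x ≤ 1
      · rw [indicator_of_mem (show x ∈ Iic 1 from hx1), min_eq_right (by nlinarith)]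
        have h2 := exp_neg_le_quadratic hαx
        rw [← neg_mul] at h2
        simp only [Pi.one_apply]
        nlinarith
      · rw [indicator_of_notMem (show x ∉ Iic 1 from hx1)]
        have : Real.exp (-α * x) ≤ 1 := Real.exp_le_one_iff.2 (by linarith)
        have : 0 ≤ α ^ 2 * min 1 (x ^ 2) := by positivity
        linarith
    · rw [integral_undef hi]; positivity
  have h2 : -c * α ≤ |c| * α ^ 2 := by
    have := neg_abs_le c
    have := abs_nonneg c
    nlinarith
  unfold upExponent
  nlinarith

end LaplaceExponent

/-! ### Dyadic grids and right-continuous paths. -/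

section Dyadic

/-- The dyadic mesh `2⁻ᵏ`. -/
noncomputable def mesh (k : ℕ) : ℝ≥0 := (1 / 2) ^ k

lemma mesh_pos (k : ℕ) : 0 < mesh k := by unfold mesh; positivity

lemma mesh_le_one (k : ℕ) : mesh k ≤ 1 := by
  unfold mesh
  exact pow_le_one₀ (by positivity) (NNReal.half_lt_self one_ne_zero).le

lemma mesh_eq_two_mul (k : ℕ) : mesh k = 2 * mesh (k + 1) := by
  unfold mesh; rw [pow_succ]; field_simp

lemma tendsto_mesh : Tendsto (fun k => (mesh k : ℝ)) atTop (𝓝 0) := by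
  have := tendsto_pow_atTop_nhds_zero_of_lt_one (r := (1 / 2 : ℝ)) (by norm_num) (by norm_num)
  simpa [mesh] using this

/-- A right-continuous path is bounded by any bound on the dyadic times. -/
lemma le_of_forall_dyadic_le {x : ℝ≥0 → ℝ}
    (hx : ∀ t, ContinuousWithinAt x (Ici t) t) {C : ℝ}
    (h : ∀ (k n : ℕ), x (n * mesh k) ≤ C) (t : ℝ≥0) : x t ≤ C := by
  -- The `+ 1` selects the grid point to the right of `t`, so that right continuity suffices.
  let s : ℕ → ℝ≥0 := fun k => ((⌊t / mesh k⌋₊ + 1 : ℕ) : ℝ≥0) * mesh k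
  have hlow : ∀ k, t ≤ s k := fun k => by
    have h1 := (Nat.lt_floor_add_one (t / mesh k)).le
    rw [div_le_iff₀ (mesh_pos k)] at h1
    simpa [s] using h1
  have hup : ∀ k, s k ≤ t + mesh k := fun k => by
    have h1 := Nat.floor_le (zero_le (a := t / mesh k))
    rw [le_div_iff₀ (mesh_pos k)] at h1
    simp only [s, Nat.cast_add, Nat.cast_one, add_mul, one_mul]
    gcongr
  have hs : Tendsto s atTop (𝓝[≥] t) := by
    refine tendsto_nhdsWithin_iff.2 ⟨?_, Eventually.of_forall hlow⟩
    have hm : Tendsto (fun k => t + mesh k) atTop (𝓝 t) := by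
      have : Tendsto mesh atTop (𝓝 0) := by
        rw [← NNReal.tendsto_coe]; exact tendsto_mesh
      simpa using this.const_add t
    exact tendsto_of_tendsto_of_tendsto_of_le_of_le tendsto_const_nhds hm hlow hup
  exact le_of_tendsto ((hx t).tendsto.comp hs) (Eventually.of_forall fun k => h k _)

end Dyadic

/-! ### The Lévy process on a grid as a random walk. -/

section LevyWalk

variable {Ω : Type*} {m : MeasurableSpace Ω} {P : Measure Ω} {𝓕 : Filtration ℝ≥0 m}
  {X : ℝ≥0 → Ω → ℝ}

/-- The increments of `X` on the dyadic grid of mesh `2⁻ᵏ`. -/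
noncomputable def gridIncrement (X : ℝ≥0 → Ω → ℝ) (k i : ℕ) (ω : Ω) : ℝ :=
  X (((i + 1 : ℕ) : ℝ≥0) * mesh k) ω - X ((i : ℝ≥0) * mesh k) ω

/-- The supremum of `X` over the dyadic grid of mesh `2⁻ᵏ`. -/
noncomputable def gridSup (X : ℝ≥0 → Ω → ℝ) (k : ℕ) (ω : Ω) : ℝ :=
  walkSup fun i => gridIncrement X k i ω

lemma sum_gridIncrement {ω : Ω} (h0 : X 0 ω = 0) (k n : ℕ) :
    ∑ i ∈ Finset.range n, gridIncrement X k i ω = X ((n : ℝ≥0) * mesh k) ω := by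
  unfold gridIncrement
  rw [Finset.sum_range_sub (fun i : ℕ => X ((i : ℝ≥0) * mesh k) ω)]
  simp [h0]

lemma IsLevyProcess.measurable (h : IsLevyProcess X 𝓕 P) (t : ℝ≥0) : Measurable (X t) :=
  (h.adapted t).mono (𝓕.le t) le_rfl

lemma IsLevyProcess.identDistrib_gridIncrement (h : IsLevyProcess X 𝓕 P) (k i : ℕ) :
    IdentDistrib (gridIncrement X k i) (X (mesh k)) P P := by
  have hs := h.stationary ((i : ℝ≥0) * mesh k) (((i + 1 : ℕ) : ℝ≥0) * mesh k) (by gcongr; simp)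
  have e : ((i + 1 : ℕ) : ℝ≥0) * mesh k - (i : ℝ≥0) * mesh k = mesh k := by
    rw [Nat.cast_add, add_mul, add_tsub_cancel_left]; simp
  rw [e] at hs
  exact hs

/-- On an event where the later increment is bounded, `X t` differs from the integrable `X 1` by a
bounded amount. The event is independent of `X t`; choosing it of positive probability lets
independence divide it out. -/
lemma IsLevyProcess.integrable_of_le_one [IsProbabilityMeasure P] (h : IsLevyProcess X 𝓕 P)
    (hX : Integrable (X 1) P) {t : ℝ≥0} (ht : t ≤ 1) : Integrable (X t) P := by
  have hm : Measurable fun ω => X 1 ω - X t ω := (h.measurable 1).sub (h.measurable t)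
  obtain ⟨C, hC⟩ : ∃ C : ℕ, P {ω | |X 1 ω - X t ω| ≤ C} ≠ 0 := by
    by_contra hcon
    push Not at hcon
    have hU : (⋃ C : ℕ, {ω | |X 1 ω - X t ω| ≤ C}) = univ := by
      refine eq_univ_of_forall fun ω => mem_iUnion.2 ?_
      exact exists_nat_ge |X 1 ω - X t ω|
    have := measure_iUnion_null hcon
    rw [hU, measure_univ] at this
    exact one_ne_zero this
  have hmeas : MeasurableSet {ω | |X 1 ω - X t ω| ≤ C} :=
    measurableSet_le (by fun_prop) measurable_const
  have hind : IndepFun (X t) (fun ω => X 1 ω - X t ω) P := by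
    refine Indep.symm ?_
    exact indep_of_indep_of_le_right (h.indep t 1 ht) (h.adapted t).comap_le
  have hms : MeasurableSet {y : ℝ | |y| ≤ C} :=
    measurableSet_le (by fun_prop) measurable_const
  have hind' : IndepFun (X t)
      (fun ω => ({y : ℝ | |y| ≤ C}.indicator (1 : ℝ → ℝ)) (X 1 ω - X t ω)) P :=
    hind.comp (φ := id) measurable_id (measurable_one.indicator hms)
  have hmi : Measurable fun ω => ({y : ℝ | |y| ≤ C}.indicator (1 : ℝ → ℝ)) (X 1 ω - X t ω) :=
    (measurable_one.indicator hms).comp hm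
  have hprod : Integrable
      (X t * fun ω => ({y : ℝ | |y| ≤ C}.indicator (1 : ℝ → ℝ)) (X 1 ω - X t ω)) P := by
    refine (hX.abs.add (integrable_const (C : ℝ))).mono'
      ((h.measurable t).mul hmi).aestronglyMeasurable (ae_of_all _ fun ω => ?_)
    simp only [Pi.mul_apply, Pi.add_apply]
    by_cases hω : |X 1 ω - X t ω| ≤ C
    · rw [indicator_of_mem (show X 1 ω - X t ω ∈ {y : ℝ | |y| ≤ C} from hω), Pi.one_apply,
        mul_one, Real.norm_eq_abs]
      have := abs_sub_abs_le_abs_sub (X t ω) (X 1 ω)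
      rw [abs_sub_comm] at this
      linarith
    · rw [indicator_of_notMem (show X 1 ω - X t ω ∉ {y : ℝ | |y| ≤ C} from hω), mul_zero,
        norm_zero]
      positivity
  refine hind'.integrable_left_of_integrable_op (· * ·) 1 one_ne_zero (by simp [enorm_mul]) hprod
    (h.measurable t).aestronglyMeasurable hmi.aestronglyMeasurable ?_
  intro h0
  apply hC
  refine measure_mono_null (fun ω hω => ?_) h0
  simp only [mem_compl_iff, mem_ofPred_eq] at hω ⊢
  simp [indicator, hω]

lemma IsLevyProcess.isNegativeDriftWalk [IsProbabilityMeasure P] (h : IsLevyProcess X 𝓕 P)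
    {φ : ℝ → ℝ} (hφ : HasLaplaceExponent X φ P)
    (hX : Integrable (X 1) P) (hneg : ∫ ω, X 1 ω ∂P < 0) (k : ℕ) :
    IsNegativeDriftWalk (gridIncrement X k) P where
  meas i := (h.measurable _).sub (h.measurable _)
  indep := by
    refine iIndepFun_of_indep_past (𝓖 := fun i => 𝓕 ((i : ℝ≥0) * mesh k)) ?_ ?_ ?_
    · intro i j hij
      exact 𝓕.mono (by gcongr)
    · intro i
      exact (h.adapted _).sub ((h.adapted _).mono (𝓕.mono (by gcongr; simp)) le_rfl)
    · intro i
      exact h.indep _ _ (by gcongr; simp)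
  ident i := (h.identDistrib_gridIncrement k i).trans (h.identDistrib_gridIncrement k 0).symm
  integrable := (h.identDistrib_gridIncrement k 0).integrable_iff.2
    (h.integrable_of_le_one hX (mesh_le_one k))
  neg := by
    rw [(h.identDistrib_gridIncrement k 0).integral_eq,
      hφ.integral_eq_mul hX (h.integrable_of_le_one hX (mesh_le_one k))]
    exact mul_neg_of_pos_of_neg (mesh_pos k) hneg

lemma IsLevyProcess.integral_gridIncrement [IsProbabilityMeasure P] (h : IsLevyProcess X 𝓕 P)
    {φ : ℝ → ℝ} (hφ : HasLaplaceExponent X φ P) (hX : Integrable (X 1) P) (k : ℕ) :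
    ∫ ω, gridIncrement X k 0 ω ∂P = mesh k * ∫ ω, X 1 ω ∂P := by
  rw [(h.identDistrib_gridIncrement k 0).integral_eq,
    hφ.integral_eq_mul hX (h.integrable_of_le_one hX (mesh_le_one k))]

lemma IsLevyProcess.laplace_gridIncrement (h : IsLevyProcess X 𝓕 P)
    {φ : ℝ → ℝ} (hφ : HasLaplaceExponent X φ P) (k : ℕ) {α : ℝ} (hα : 0 ≤ α) :
    Integrable (fun ω => Real.exp (-α * gridIncrement X k 0 ω)) P ∧
      ∫ ω, Real.exp (-α * gridIncrement X k 0 ω) ∂P = Real.exp (mesh k * φ α) := by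
  have hid := (h.identDistrib_gridIncrement k 0).comp (u := fun x => Real.exp (-α * x))
    (by fun_prop)
  exact ⟨hid.integrable_iff.2 (hφ.integrable_exp hα _), hid.integral_eq.trans (hφ α hα _)⟩

lemma bddAbove_grid_of_walk {ω : Ω} (h0 : X 0 ω = 0) {k : ℕ}
    (h : BddAbove (range fun n : ℕ => ∑ i ∈ Finset.range n, gridIncrement X k i ω)) (n : ℕ) :
    X ((n : ℝ≥0) * mesh k) ω ≤ gridSup X k ω := by
  rw [← sum_gridIncrement h0]
  exact le_ciSup h n

lemma gridSup_le {ω : Ω} (h0 : X 0 ω = 0) {k : ℕ} {C : ℝ}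
    (h : ∀ n : ℕ, X ((n : ℝ≥0) * mesh k) ω ≤ C) : gridSup X k ω ≤ C :=
  ciSup_le fun n => by rw [sum_gridIncrement h0]; exact h n

/-- Each grid is contained in the next. -/
lemma monotone_gridSup {ω : Ω} (h0 : X 0 ω = 0)
    (h : ∀ k, BddAbove (range fun n : ℕ => ∑ i ∈ Finset.range n, gridIncrement X k i ω)) :
    Monotone fun k => gridSup X k ω := by
  refine monotone_nat_of_le_succ fun k => gridSup_le h0 fun n => ?_
  have := bddAbove_grid_of_walk h0 (h (k + 1)) (n * 2)
  rwa [Nat.cast_mul, Nat.cast_ofNat, mul_assoc, ← mesh_eq_two_mul] at this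

end LevyWalk

/-! ### Passage to the limit: the Pollaczek–Khinchine formula. -/

section PollaczekKhinchine

variable {Ω : Type*} {m : MeasurableSpace Ω} {P : Measure Ω}
  {𝓕 : Filtration ℝ≥0 m} {X : ℝ≥0 → Ω → ℝ} {φ : ℝ → ℝ}

open IsNegativeDriftWalk

lemma measurable_gridSup (h : IsLevyProcess X 𝓕 P) (k : ℕ) : Measurable (gridSup X k) :=
  measurable_walkSup.comp (measurable_pi_lambda _ fun _ =>
    (h.measurable _).sub (h.measurable _))

variable [IsProbabilityMeasure P]

lemma IsLevyProcess.ae_gridSup (h : IsLevyProcess X 𝓕 P) (hφ : HasLaplaceExponent X φ P)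
    (hX : Integrable (X 1) P) (hneg : ∫ ω, X 1 ω ∂P < 0) :
    ∀ᵐ ω ∂P, X 0 ω = 0 ∧
      ∀ k, BddAbove (range fun n : ℕ => ∑ i ∈ Finset.range n, gridIncrement X k i ω) := by
  filter_upwards [h.zero, ae_all_iff.2 fun k =>
    (h.isNegativeDriftWalk hφ hX hneg k).ae_bddAbove] with ω h0 hb using ⟨h0, hb⟩

/-- The exponential moments of the scaled negative part of an increment are bounded when the
exponent grows at most quadratically. -/
lemma IsLevyProcess.exp_negPart_gridIncrement (h : IsLevyProcess X 𝓕 P)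
    (hφ : HasLaplaceExponent X φ P) {C : ℝ} (hC : ∀ α : ℝ, 1 ≤ α → φ α ≤ C * α ^ 2) (k : ℕ) :
    Integrable (fun ω => Real.exp (2 * (max 0 (-gridIncrement X k 0 ω) / √(mesh k)))) P ∧
      ∫ ω, Real.exp (2 * (max 0 (-gridIncrement X k 0 ω) / √(mesh k))) ∂P
        ≤ 1 + Real.exp (4 * C) := by
  have hr : 0 < √(mesh k : ℝ) := Real.sqrt_pos.2 (mesh_pos k)
  have hr1 : √(mesh k : ℝ) ≤ 1 := by
    rw [Real.sqrt_le_one]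
    exact mesh_le_one k
  have hr2 : √(mesh k : ℝ) ^ 2 = mesh k := Real.sq_sqrt (mesh k).2
  -- At this argument quadratic growth exactly cancels the mesh: `h φ(2/√h) ≤ h · C · 4/h = 4C`.
  obtain ⟨hi, he⟩ := h.laplace_gridIncrement hφ k (α := 2 / √(mesh k)) (by positivity)
  have hb := (integrable_const (μ := P) (1 : ℝ)).add hi
  have hpt : ∀ ω, Real.exp (2 * (max 0 (-gridIncrement X k 0 ω) / √(mesh k)))
      ≤ 1 + Real.exp (-(2 / √(mesh k)) * gridIncrement X k 0 ω) := by
    intro ω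
    rcases le_total 0 (gridIncrement X k 0 ω) with hx | hx
    · rw [max_eq_left (by linarith)]
      have := Real.exp_pos (-(2 / √(mesh k)) * gridIncrement X k 0 ω)
      simp only [zero_div, mul_zero, Real.exp_zero]
      linarith
    · rw [max_eq_right (by linarith)]
      have e : 2 * (-gridIncrement X k 0 ω / √(mesh k))
          = -(2 / √(mesh k)) * gridIncrement X k 0 ω := by ring
      rw [e]
      linarith
  have hm : Measurable (gridIncrement X k 0) := (h.measurable _).sub (h.measurable _)
  have hint : Integrable
      (fun ω => Real.exp (2 * (max 0 (-gridIncrement X k 0 ω) / √(mesh k)))) P := by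
    refine hb.mono' (Measurable.aestronglyMeasurable (by fun_prop)) (ae_of_all _ fun ω => ?_)
    rw [Real.norm_eq_abs, Real.abs_exp]
    exact hpt ω
  refine ⟨hint, (integral_mono hint hb hpt).trans ?_⟩
  simp only [Pi.add_apply]
  rw [integral_add (integrable_const _) hi, he]
  simp only [integral_const, probReal_univ, smul_eq_mul, mul_one, add_le_add_iff_left,
    Real.exp_le_exp]
  have h1 := hC (2 / √(mesh k)) (by rw [le_div_iff₀ hr]; linarith)
  calc (mesh k : ℝ) * φ (2 / √(mesh k)) ≤ mesh k * (C * (2 / √(mesh k)) ^ 2) := by gcongr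
    _ = 4 * C := by
      rw [div_pow, hr2]
      have : (mesh k : ℝ) ≠ 0 := NNReal.coe_ne_zero.2 (mesh_pos k).ne'
      field_simp
      norm_num

/-- Convergence of the Laplace transforms of the suprema over the dyadic grids. -/
lemma IsLevyProcess.tendsto_laplace_gridSup (h : IsLevyProcess X 𝓕 P)
    (hφ : HasLaplaceExponent X φ P) {C : ℝ} (hC : ∀ α : ℝ, 1 ≤ α → φ α ≤ C * α ^ 2)
    (hX : Integrable (X 1) P) (hneg : ∫ ω, X 1 ω ∂P < 0) {α : ℝ} (hα : 0 < α) :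
    Tendsto (fun k => ∫ ω, Real.exp (-α * gridSup X k ω) ∂P) atTop
      (𝓝 (α * (-∫ ω, X 1 ω ∂P) / φ α)) := by
  set a := -∫ ω, X 1 ω ∂P with ha
  have hw := fun k => h.isNegativeDriftWalk hφ hX hneg k
  have hφα := hφ.pos hX hneg hα
  have hr2 : ∀ k, √(mesh k : ℝ) ^ 2 = mesh k := fun k => Real.sq_sqrt (mesh k).2
  have hmesh : ∀ k, (0 : ℝ) < mesh k := mesh_pos
  have hED : ∀ k, ∫ ω, deficit (gridIncrement X k) ω ∂P = a * mesh k := fun k => by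
    rw [(hw k).integral_deficit fun β hβ => (h.laplace_gridIncrement hφ k hβ).1,
      h.integral_gridIncrement hφ hX, ha]
    ring
  -- The remainder estimate at scale `r = √mesh`. Its antitonicity hypothesis holds because the
  -- shifted supremum has the law of the grid supremum, which increases with `k`.
  have hR : Tendsto (fun k => (∫ ω, deficit (gridIncrement X k) ω ^ 2
      * Real.exp (α * deficit (gridIncrement X k) ω) ∂P) / √(mesh k : ℝ) ^ 2) atTop (𝓝 0) := by
    refine tendsto_integral_sq_exp_deficit (x := fun k => gridIncrement X k 0)
      (w := fun k ω => walkSup fun i => gridIncrement X k (i + 1) ω)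
      (K := 1 + Real.exp (4 * C)) (a := a) (fun k => Real.sqrt_pos.2 (hmesh k)) ?_
      (fun k => (hw k).meas 0) (fun k => (hw k).measurable_walkSup_shift 1)
      (fun k => (hw k).indepFun_walkSup_shift) (fun k => (hw k).ae_walkSup_shift_nonneg)
      (fun k => (h.exp_negPart_gridIncrement hφ hC k).1)
      (fun k => (h.exp_negPart_gridIncrement hφ hC k).2)
      (fun k => (hw k).integrable_deficit) (fun k => by rw [hr2]; exact (hED k).le) ?_ α
    · simpa [Function.comp_def] using (Real.continuous_sqrt.tendsto 0).comp tendsto_mesh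
    · intro δ
      have e : ∀ k, P.real {ω | (walkSup fun i => gridIncrement X k (i + 1) ω) < δ}
          = P.real {ω | gridSup X k ω < δ} := fun k => by
        have := (hw k).identDistrib_walkSup_shift.measure_mem_eq (measurableSet_Iio (a := δ))
        exact congrArg ENNReal.toReal this
      simp_rw [e]
      intro j k hjk
      refine ENNReal.toReal_mono (measure_ne_top _ _) (measure_mono_ae ?_)
      filter_upwards [h.ae_gridSup hφ hX hneg] with ω hω hlt
      exact lt_of_le_of_lt (monotone_gridSup hω.1 hω.2 hjk) hlt
  have hnum : Tendsto (fun k => (∫ ω, Real.exp (α * deficit (gridIncrement X k) ω) ∂P - 1)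
      / mesh k) atTop (𝓝 (α * a)) := by
    have hsq : ∀ y : ℝ, y ^ 2 * Real.exp (α * y) ≤ 2 * Real.exp ((α + 1) * |y|) := by
      intro y
      have h1 := Real.pow_div_factorial_le_exp |y| (abs_nonneg y) 2
      norm_num [Nat.factorial] at h1
      have h2 : Real.exp (α * y) ≤ Real.exp (α * |y|) :=
        Real.exp_le_exp.2 (mul_le_mul_of_nonneg_left (le_abs_self y) hα.le)
      rw [add_mul, Real.exp_add, one_mul]
      nlinarith [Real.exp_pos (α * |y|), Real.exp_pos (α * y), Real.exp_pos |y|, sq_nonneg y]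
    -- The sandwich integrates `1 + y ≤ e^y ≤ 1 + y + y² e^y` at `y = αD`. The moment at `α + 1` is
    -- needed only to make `D² e^{αD}` integrable.
    have hbound : ∀ k, α * a ≤ (∫ ω, Real.exp (α * deficit (gridIncrement X k) ω) ∂P - 1) / mesh k
        ∧ (∫ ω, Real.exp (α * deficit (gridIncrement X k) ω) ∂P - 1) / mesh k
          ≤ α * a + α ^ 2 * ((∫ ω, deficit (gridIncrement X k) ω ^ 2
            * Real.exp (α * deficit (gridIncrement X k) ω) ∂P) / √(mesh k : ℝ) ^ 2) := by
      intro k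
      have hiD := (hw k).integrable_deficit
      have hie := (hw k).integrable_exp_deficit hα.le (h.laplace_gridIncrement hφ k hα.le).1
      have hie' := (hw k).integrable_exp_deficit (add_pos hα one_pos).le
        (h.laplace_gridIncrement hφ k (add_pos hα one_pos).le).1
      have hi2 : Integrable (fun ω => deficit (gridIncrement X k) ω ^ 2
          * Real.exp (α * deficit (gridIncrement X k) ω)) P := by
        have hmd := (hw k).measurable_deficit
        refine (hie'.const_mul 2).mono' (Measurable.aestronglyMeasurable (by fun_prop))
          (ae_of_all _ fun ω => ?_)
        rw [Real.norm_eq_abs, abs_of_nonneg (by positivity)]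
        have := hsq (deficit (gridIncrement X k) ω)
        rwa [abs_of_nonneg (deficit_nonneg ω)] at this
      rw [hr2]
      constructor
      · rw [le_div_iff₀ (hmesh k), mul_assoc, ← hED k, le_sub_iff_add_le, ← integral_const_mul]
        have e : ∫ ω, (α * deficit (gridIncrement X k) ω + 1) ∂P
            = ∫ ω, α * deficit (gridIncrement X k) ω ∂P + 1 := by
          rw [integral_add (hiD.const_mul α) (integrable_const _)]; simp
        rw [← e]
        exact integral_mono ((hiD.const_mul α).add (integrable_const _)) hie
          fun ω => Real.add_one_le_exp _
      · rw [div_le_iff₀ (hmesh k), add_mul, mul_assoc α, ← hED k, mul_assoc (α ^ 2),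
          div_mul_cancel₀ _ (hmesh k).ne', sub_le_iff_le_add, ← integral_const_mul,
          ← integral_const_mul]
        have e : ∫ ω, (α * deficit (gridIncrement X k) ω + α ^ 2 * (deficit (gridIncrement X k) ω ^ 2
              * Real.exp (α * deficit (gridIncrement X k) ω)) + 1) ∂P
            = ∫ ω, α * deficit (gridIncrement X k) ω ∂P
              + ∫ ω, α ^ 2 * (deficit (gridIncrement X k) ω ^ 2
              * Real.exp (α * deficit (gridIncrement X k) ω)) ∂P + 1 := by
          rw [integral_add (f := fun ω => α * deficit (gridIncrement X k) ω
              + α ^ 2 * (deficit (gridIncrement X k) ω ^ 2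
              * Real.exp (α * deficit (gridIncrement X k) ω))) ((hiD.const_mul α).add (hi2.const_mul _)) (integrable_const _),
            integral_add (hiD.const_mul α) (hi2.const_mul _)]
          simp
        rw [← e]
        refine integral_mono hie
          (((hiD.const_mul α).add (hi2.const_mul _)).add (integrable_const _)) fun ω => ?_
        have := exp_sub_one_sub_le (mul_nonneg hα.le (deficit_nonneg (ξ := gridIncrement X k) ω))
        simp only
        linarith
    refine tendsto_of_tendsto_of_tendsto_of_le_of_le tendsto_const_nhds ?_
      (fun k => (hbound k).1) (fun k => (hbound k).2)
    simpa using (hR.const_mul (α ^ 2)).const_add (α * a)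
  have hden : Tendsto (fun k => (Real.exp (mesh k * φ α) - 1) / mesh k) atTop (𝓝 (φ α)) := by
    have h1 := tendsto_exp_sub_one_div (-φ α)
    rw [neg_neg] at h1
    have h2 : Tendsto (fun k => (mesh k : ℝ)) atTop (𝓝[>] 0) :=
      tendsto_nhdsWithin_iff.2 ⟨tendsto_mesh, Eventually.of_forall hmesh⟩
    refine (h1.comp h2).congr fun k => ?_
    simp
  refine (hnum.div hden hφα.ne').congr fun k => ?_
  have hid := (hw k).laplace_walkSup hα.le (h.laplace_gridIncrement hφ k hα.le).1
  rw [(h.laplace_gridIncrement hφ k hα.le).2] at hid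
  simp only [Pi.div_apply]
  rw [← hid]
  have h1 : Real.exp (mesh k * φ α) - 1 ≠ 0 := by
    have : 1 < Real.exp (mesh k * φ α) := Real.one_lt_exp_iff.2 (mul_pos (hmesh k) hφα)
    linarith
  have h2 := (hmesh k).ne'
  unfold gridSup
  field_simp

/-- A Lévy process with negative mean whose exponent grows at most quadratically is bounded
above. -/
lemma IsLevyProcess.ae_bddAbove_gridSup (h : IsLevyProcess X 𝓕 P)
    (hφ : HasLaplaceExponent X φ P) {C : ℝ} (hC : ∀ α : ℝ, 1 ≤ α → φ α ≤ C * α ^ 2)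
    (hX : Integrable (X 1) P) (hneg : ∫ ω, X 1 ω ∂P < 0) :
    ∀ᵐ ω ∂P, BddAbove (range fun k => gridSup X k ω) := by
  set B := {ω | BddAbove (range fun k => gridSup X k ω)} with hB
  have hBm : MeasurableSet B := measurableSet_bddAbove_range (measurable_gridSup h)
  -- Off `B` the grid suprema increase to infinity, so their exponentials vanish in the limit; on
  -- `B` they are at most one.
  have hle : ∀ α : ℝ, 0 < α → α * (-∫ ω, X 1 ω ∂P) / φ α ≤ P.real B := by
    intro α hα
    have hlim := h.tendsto_laplace_gridSup hφ hC hX hneg hα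
    have hoff : Tendsto (fun k => ∫ ω, Bᶜ.indicator (fun ω => Real.exp (-α * gridSup X k ω)) ω ∂P)
        atTop (𝓝 (∫ _, (0 : ℝ) ∂P)) := by
      refine tendsto_integral_of_dominated_convergence (fun _ => 1) ?_ (integrable_const _) ?_ ?_
      · intro k
        have := measurable_gridSup h k
        exact (Measurable.indicator (by fun_prop) hBm.compl).aestronglyMeasurable
      · intro k
        filter_upwards [h.ae_gridSup hφ hX hneg] with ω hω
        rw [norm_indicator_eq_indicator_norm]
        refine indicator_le_self' (fun _ _ => norm_nonneg _) ω |>.trans ?_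
        rw [Real.norm_eq_abs, Real.abs_exp, Real.exp_le_one_iff]
        have : 0 ≤ gridSup X k ω := walkSup_nonneg (hω.2 k)
        nlinarith
      · filter_upwards [h.ae_gridSup hφ hX hneg] with ω hω
        by_cases hωB : ω ∈ B
        · simp [hωB]
        · simp only [mem_compl_iff, hωB, not_false_eq_true, indicator_of_mem]
          have ht : Tendsto (fun k => gridSup X k ω) atTop atTop := by
            refine tendsto_atTop_atTop_of_monotone (monotone_gridSup hω.1 hω.2) fun b => ?_
            by_contra hcon
            push Not at hcon
            exact hωB ⟨b, by rintro _ ⟨k, rfl⟩; exact (hcon k).le⟩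
          refine Real.tendsto_exp_atBot.comp ?_
          exact ht.const_mul_atTop_of_neg (by linarith)
    rw [integral_zero] at hoff
    have hsum : ∀ k, ∫ ω, Real.exp (-α * gridSup X k ω) ∂P
        ≤ P.real B + ∫ ω, Bᶜ.indicator (fun ω => Real.exp (-α * gridSup X k ω)) ω ∂P := by
      intro k
      have hi := (h.isNegativeDriftWalk hφ hX hneg k).integrable_exp_walkSup hα.le
      change Integrable (fun ω => Real.exp (-α * gridSup X k ω)) P at hi
      rw [← integral_indicator_one hBm,
        ← integral_add (f := B.indicator 1) ((integrable_const (1 : ℝ)).indicator hBm) (hi.indicator hBm.compl)]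
      refine integral_mono_ae hi
        (((integrable_const (1 : ℝ)).indicator hBm).add (hi.indicator hBm.compl)) ?_
      filter_upwards [h.ae_gridSup hφ hX hneg] with ω hω
      by_cases hωB : ω ∈ B
      · have : 0 ≤ gridSup X k ω := walkSup_nonneg (hω.2 k)
        simp only [Pi.one_apply, hωB, indicator_of_mem, mem_compl_iff, not_true_eq_false,
          not_false_eq_true, indicator_of_notMem, add_zero, Real.exp_le_one_iff]
        nlinarith
      · simp [hωB]
    have := le_of_tendsto_of_tendsto' hlim (hoff.const_add (P.real B)) hsum
    simpa using this
  -- As `α ↓ 0`, `φ(α)/α` tends to minus the mean, so the lower bound tends to one.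
  have hone : (1 : ℝ) ≤ P.real B := by
    have ha : -∫ ω, X 1 ω ∂P ≠ 0 := by linarith
    have hd := hφ.hasDerivWithinAt_zero hX
    rw [← hasDerivWithinAt_Ioi_iff_Ici, hasDerivWithinAt_iff_tendsto_slope' (by simp)] at hd
    have hlim := (hd.inv₀ ha).const_mul (-∫ ω, X 1 ω ∂P)
    rw [mul_inv_cancel₀ ha] at hlim
    refine le_of_tendsto hlim ?_
    filter_upwards [self_mem_nhdsWithin] with α hα
    have hα' : 0 < α := hα
    refine le_trans (le_of_eq ?_) (hle α hα')
    rw [slope_def_field, hφ.apply_zero]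
    simp only [sub_zero, inv_div]
    ring
  have h1 : P B = 1 := by
    refine le_antisymm prob_le_one ?_
    rw [← ENNReal.ofReal_one, ← ofReal_measureReal (measure_ne_top P B)]
    exact ENNReal.ofReal_le_ofReal hone
  exact (prob_compl_eq_zero_iff hBm).2 h1

/-- Right continuity makes the supremum over all times equal to that over dyadic times, the
increasing limit of the grid suprema. -/
lemma IsLevyProcess.ae_sup (h : IsLevyProcess X 𝓕 P)
    (hφ : HasLaplaceExponent X φ P) {C : ℝ} (hC : ∀ α : ℝ, 1 ≤ α → φ α ≤ C * α ^ 2)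
    (hX : Integrable (X 1) P) (hneg : ∫ ω, X 1 ω ∂P < 0) :
    ∀ᵐ ω ∂P, BddAbove (range fun s : ℝ≥0 => X s ω) ∧ 0 ≤ ⨆ s : ℝ≥0, X s ω ∧
      Tendsto (fun k => gridSup X k ω) atTop (𝓝 (⨆ s : ℝ≥0, X s ω)) := by
  filter_upwards [h.ae_gridSup hφ hX hneg, h.ae_bddAbove_gridSup hφ hC hX hneg, h.rightCont]
    with ω hω hb hrc
  have hle : ∀ s, X s ω ≤ ⨆ k, gridSup X k ω := by
    refine le_of_forall_dyadic_le hrc fun k n => ?_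
    exact (bddAbove_grid_of_walk hω.1 (hω.2 k) n).trans (le_ciSup hb k)
  have hbdd : BddAbove (range fun s : ℝ≥0 => X s ω) := by
    refine ⟨⨆ k, gridSup X k ω, ?_⟩
    rintro _ ⟨s, rfl⟩
    exact hle s
  have hnn : 0 ≤ ⨆ s : ℝ≥0, X s ω := by
    rw [← hω.1]; exact le_ciSup hbdd 0
  refine ⟨hbdd, hnn, ?_⟩
  have e : ⨆ s : ℝ≥0, X s ω = ⨆ k, gridSup X k ω :=
    le_antisymm (ciSup_le hle)
      (ciSup_le fun k => gridSup_le hω.1 fun n => le_ciSup hbdd _)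
  rw [e]
  exact tendsto_atTop_ciSup (monotone_gridSup hω.1 hω.2) hb

/-- The generalized Pollaczek–Khinchine formula. -/
lemma IsLevyProcess.laplace_sup (h : IsLevyProcess X 𝓕 P)
    (hφ : HasLaplaceExponent X φ P) {C : ℝ} (hC : ∀ α : ℝ, 1 ≤ α → φ α ≤ C * α ^ 2)
    (hX : Integrable (X 1) P) (hneg : ∫ ω, X 1 ω ∂P < 0) {α : ℝ} (hα : 0 < α) :
    ∫ ω, Real.exp (-α * ⨆ s : ℝ≥0, X s ω) ∂P = α * (-∫ ω, X 1 ω ∂P) / φ α := by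
  refine tendsto_nhds_unique ?_ (h.tendsto_laplace_gridSup hφ hC hX hneg hα)
  refine tendsto_integral_of_dominated_convergence (fun _ => 1) ?_ (integrable_const _) ?_ ?_
  · intro k
    have := measurable_gridSup h k
    exact Measurable.aestronglyMeasurable (by fun_prop)
  · intro k
    filter_upwards [h.ae_gridSup hφ hX hneg] with ω hω
    rw [Real.norm_eq_abs, Real.abs_exp, Real.exp_le_one_iff]
    have : 0 ≤ gridSup X k ω := walkSup_nonneg (hω.2 k)
    nlinarith
  · filter_upwards [h.ae_sup hφ hC hX hneg] with ω hω
    exact (Real.continuous_exp.tendsto _).comp (hω.2.2.const_mul (-α))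

end PollaczekKhinchine

/-! ### Laplace transform of the stationary excess law. -/

section StationaryExcess

/-- Markov's inequality for `min 1 x` bounds the mass of `[1/(n+1), ∞)`, and `(-∞, 0]` is null.
Needed for Tonelli's theorem. -/
lemma IsSubordinatorLevyMeasure.sigmaFinite {ν : Measure ℝ} (hν : IsSubordinatorLevyMeasure ν) :
    SigmaFinite ν := by
  let S : Set (Set ℝ) := insert (Iic 0) (range fun n : ℕ => Ici (1 / ((n : ℝ) + 1)))
  refine Measure.sigmaFinite_of_countable (S := S) ((countable_range _).insert _) ?_ ?_
  · rintro s (rfl | ⟨n, rfl⟩)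
    · rw [hν.1]; exact ENNReal.zero_lt_top
    · have hpos : (0 : ℝ) < 1 / ((n : ℝ) + 1) := by positivity
      have hle1 : 1 / ((n : ℝ) + 1) ≤ 1 := by
        rw [div_le_one (by positivity)]
        have : (0 : ℝ) ≤ n := Nat.cast_nonneg n
        linarith
      have hsub : Ici (1 / ((n : ℝ) + 1))
          ⊆ {x | ENNReal.ofReal (1 / ((n : ℝ) + 1)) ≤ ENNReal.ofReal (min 1 x)} := fun x hx =>
        ENNReal.ofReal_le_ofReal (le_min hle1 hx)
      refine (measure_mono hsub).trans_lt ?_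
      refine (meas_ge_le_lintegral_div (by fun_prop) (by simpa using hpos)
        ENNReal.ofReal_ne_top).trans_lt ?_
      exact ENNReal.div_lt_top hν.2.ne (by simpa using hpos)
  · refine eq_univ_of_forall fun x => ?_
    rcases le_or_gt x 0 with hx | hx
    · exact ⟨Iic 0, mem_insert _ _, hx⟩
    · obtain ⟨n, hn⟩ := exists_nat_one_div_lt hx
      exact ⟨_, mem_insert_of_mem _ ⟨n, rfl⟩, hn.le⟩

lemma IsSubordinatorLevyMeasure.integrable_one_sub_exp {ν : Measure ℝ}
    (hν : IsSubordinatorLevyMeasure ν) {α : ℝ} (hα : 0 ≤ α) :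
    Integrable (fun x => 1 - Real.exp (-α * x)) (ν.restrict (Ioi 0)) := by
  have hint : Integrable (fun x : ℝ => min 1 x) (ν.restrict (Ioi 0)) := by
    refine ⟨by fun_prop, ?_⟩
    rw [hasFiniteIntegral_iff_ofReal]
    · exact (lintegral_mono' Measure.restrict_le_self le_rfl).trans_lt hν.2
    · filter_upwards [ae_restrict_mem measurableSet_Ioi] with x hx
      exact le_min zero_le_one (le_of_lt hx)
  refine (hint.const_mul (max 1 α)).mono' (by fun_prop) ?_
  filter_upwards [ae_restrict_mem measurableSet_Ioi] with x hx
  have hx0 : 0 < x := hx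
  have h1 : Real.exp (-α * x) ≤ 1 := Real.exp_le_one_iff.2 (by nlinarith)
  rw [Real.norm_eq_abs, abs_of_nonneg (by linarith)]
  have h2 := Real.add_one_le_exp (-α * x)
  have h3 := Real.exp_pos (-α * x)
  rcases le_total x 1 with hx1 | hx1
  · rw [min_eq_right hx1]
    nlinarith [le_max_right 1 α]
  · rw [min_eq_left hx1]
    linarith [le_max_left 1 α]

lemma lintegral_exp_Ioo {α : ℝ} (hα : 0 < α) {y : ℝ} (hy : 0 ≤ y) :
    ∫⁻ x in Ioo 0 y, ENNReal.ofReal (Real.exp (-α * x))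
      = ENNReal.ofReal ((1 - Real.exp (-α * y)) / α) := by
  have hc : Continuous fun x : ℝ => Real.exp (-α * x) := by fun_prop
  rw [← ofReal_integral_eq_lintegral_ofReal
    ((hc.integrableOn_Icc (a := 0) (b := y)).mono_set Ioo_subset_Icc_self)
    (ae_of_all _ fun x => (Real.exp_pos _).le),
    ← integral_Ioc_eq_integral_Ioo, ← intervalIntegral.integral_of_le hy]
  congr 1
  have hd : ∀ x ∈ uIcc 0 y, HasDerivAt (fun x : ℝ => -Real.exp (-α * x) / α)
      (Real.exp (-α * x)) x := by
    intro x _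
    have h1 : HasDerivAt (fun x : ℝ => -α * x) (-α) x := by
      simpa using (hasDerivAt_id x).const_mul (-α)
    have h2 := (h1.exp.neg).div_const α
    refine h2.congr_deriv ?_
    field_simp
  rw [intervalIntegral.integral_eq_sub_of_hasDerivAt hd (hc.intervalIntegrable _ _)]
  simp
  ring

/-- Laplace transform of the tail of a Lévy measure. -/
lemma lintegral_exp_mul_tail {ν : Measure ℝ} [SFinite ν] {α : ℝ} (hα : 0 < α) :
    ∫⁻ x in Ioi 0, ENNReal.ofReal (Real.exp (-α * x)) * ν (Ioi x)
      = ∫⁻ y in Ioi 0, ENNReal.ofReal ((1 - Real.exp (-α * y)) / α) ∂ν := by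
  have h1 : ∀ x : ℝ, ENNReal.ofReal (Real.exp (-α * x)) * ν (Ioi x)
      = ∫⁻ y, (Ioi x).indicator (fun _ => ENNReal.ofReal (Real.exp (-α * x))) y ∂ν := fun x => by
    rw [lintegral_indicator measurableSet_Ioi, setLIntegral_const]
  simp_rw [h1]
  rw [lintegral_lintegral_swap, ← lintegral_indicator measurableSet_Ioi]
  · refine lintegral_congr fun y => ?_
    have h2 : ∀ x : ℝ, (Ioi x).indicator (fun _ => ENNReal.ofReal (Real.exp (-α * x))) y
        = (Iio y).indicator (fun x => ENNReal.ofReal (Real.exp (-α * x))) x := fun x => by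
      simp [indicator]
    simp_rw [h2]
    rw [lintegral_indicator measurableSet_Iio, Measure.restrict_restrict measurableSet_Iio,
      inter_comm, Ioi_inter_Iio]
    by_cases hy : 0 < y
    · rw [lintegral_exp_Ioo hα hy.le, indicator_of_mem (show y ∈ Ioi 0 from hy)]
    · rw [indicator_of_notMem (show y ∉ Ioi 0 from hy), Ioo_eq_empty hy]
      simp
  · have e : Function.uncurry (fun x y : ℝ =>
        (Ioi x).indicator (fun _ => ENNReal.ofReal (Real.exp (-α * x))) y)
        = {p : ℝ × ℝ | p.1 < p.2}.indicator fun p => ENNReal.ofReal (Real.exp (-α * p.1)) := by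
      ext ⟨x, y⟩
      simp [indicator, Function.uncurry]
    rw [e]
    exact (Measurable.indicator (by fun_prop)
      (measurableSet_lt measurable_fst measurable_snd)).aemeasurable

/-- Stated in `ℝ≥0∞` so that `α ↓ 0` can be taken by monotone convergence before `∫ x ν(dx)` is
known to be finite. -/
lemma ofReal_downExponent_div {c : ℝ} (hc : 0 ≤ c) {ν : Measure ℝ}
    (hν : IsSubordinatorLevyMeasure ν) {α : ℝ} (hα : 0 < α) :
    ENNReal.ofReal c + ∫⁻ y in Ioi 0, ENNReal.ofReal ((1 - Real.exp (-α * y)) / α) ∂ν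
      = ENNReal.ofReal (downExponent c ν α / α) := by
  have hnn : 0 ≤ᵐ[ν.restrict (Ioi 0)] fun y => (1 - Real.exp (-α * y)) / α := by
    filter_upwards [ae_restrict_mem measurableSet_Ioi] with x hx
    have hx0 : 0 < x := hx
    have h1 : Real.exp (-α * x) ≤ 1 := Real.exp_le_one_iff.2 (by nlinarith)
    exact div_nonneg (by linarith) hα.le
  rw [← ofReal_integral_eq_lintegral_ofReal ((hν.integrable_one_sub_exp hα.le).div_const α) hnn,
    ← ENNReal.ofReal_add hc (integral_nonneg_of_ae hnn), integral_div]
  congr 1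
  unfold downExponent
  field_simp

/-- The mean of a subordinator, in terms of its characteristics. -/
lemma ofReal_add_lintegral_eq {c : ℝ} (hc : 0 ≤ c) {ν : Measure ℝ}
    (hν : IsSubordinatorLevyMeasure ν) {d : ℝ}
    (hd : HasDerivWithinAt (downExponent c ν) d (Ici 0) 0) :
    ENNReal.ofReal c + ∫⁻ x in Ioi 0, ENNReal.ofReal x ∂ν = ENNReal.ofReal d := by
  have hmpos : ∀ k, (0 : ℝ) < mesh k := mesh_pos
  have hm0 : Tendsto (fun k => (mesh k : ℝ)) atTop (𝓝[>] 0) :=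
    tendsto_nhdsWithin_iff.2 ⟨tendsto_mesh, Eventually.of_forall hmpos⟩
  have h1 : Tendsto (fun k => ∫⁻ y in Ioi 0,
      ENNReal.ofReal ((1 - Real.exp (-(mesh k : ℝ) * y)) / mesh k) ∂ν) atTop
      (𝓝 (∫⁻ y in Ioi 0, ENNReal.ofReal y ∂ν)) := by
    refine lintegral_tendsto_of_tendsto_of_monotone (fun k => by fun_prop)
      (ae_of_all _ fun y => ?_) (ae_of_all _ fun y => ?_)
    -- Halving the mesh increases the quotient: with `u = e^{-by}` the claim `(1 - u²)/(2b) ≤ (1 -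
    -- u)/b` is `0 ≤ (1 - u)²`.
    · refine monotone_nat_of_le_succ fun k => ENNReal.ofReal_le_ofReal ?_
      have e : (mesh k : ℝ) = 2 * mesh (k + 1) := by exact_mod_cast mesh_eq_two_mul k
      rw [e]
      have hp := hmpos (k + 1)
      set b := (mesh (k + 1) : ℝ)
      have e2 : Real.exp (-(2 * b) * y) = Real.exp (-b * y) ^ 2 := by
        rw [← Real.exp_nat_mul]; congr 1; push_cast; ring
      rw [e2, div_le_div_iff₀ (by positivity) hp]
      nlinarith [mul_nonneg hp.le (sq_nonneg (1 - Real.exp (-b * y)))]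
    · refine (ENNReal.continuous_ofReal.tendsto _).comp ?_
      have := ((tendsto_exp_sub_one_div y).comp hm0).neg
      rw [neg_neg] at this
      refine this.congr fun k => ?_
      simp only [Function.comp_apply]
      ring
  have h2 : Tendsto (fun k => ENNReal.ofReal (downExponent c ν (mesh k) / mesh k)) atTop
      (𝓝 (ENNReal.ofReal d)) := by
    refine (ENNReal.continuous_ofReal.tendsto _).comp ?_
    rw [← hasDerivWithinAt_Ioi_iff_Ici, hasDerivWithinAt_iff_tendsto_slope' (by simp)] at hd
    refine (hd.comp hm0).congr fun k => ?_
    simp [slope_def_field, downExponent]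
  refine tendsto_nhds_unique (h1.const_add (ENNReal.ofReal c)) (h2.congr fun k => ?_)
  exact (ofReal_downExponent_div hc hν (hmpos k)).symm

lemma stationaryExcess_Iio {c : ℝ} {ν : Measure ℝ} : stationaryExcess c ν (Iio 0) = 0 := by
  have h : ((volume.restrict (Ioi 0)).withDensity fun x => ν (Ioi x)) (Iio 0) = 0 := by
    refine withDensity_absolutelyContinuous _ _ ?_
    rw [Measure.restrict_apply measurableSet_Iio]
    have : Iio (0 : ℝ) ∩ Ioi 0 = ∅ := by
      ext x; simp only [mem_inter_iff, mem_Iio, mem_Ioi, mem_empty_iff_false, iff_false]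
      intro hx; linarith [hx.1, hx.2]
    rw [this, measure_empty]
  simp [stationaryExcess, h]

/-- Laplace transform of the stationary excess law. -/
lemma laplace_stationaryExcess {c : ℝ} (hc : 0 ≤ c) {ν : Measure ℝ}
    (hν : IsSubordinatorLevyMeasure ν) {d : ℝ} (hd0 : 0 < d)
    (hd : HasDerivWithinAt (downExponent c ν) d (Ici 0) 0) {α : ℝ} (hα : 0 < α) :
    ∫ x, Real.exp (-α * x) ∂(stationaryExcess c ν) = downExponent c ν α / (d * α) := by
  have := hν.sigmaFinite
  have hanti : Measurable fun x : ℝ => ν (Ioi x) :=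
    (show Antitone fun x : ℝ => ν (Ioi x) from
      fun x y hxy => measure_mono (Ioi_subset_Ioi hxy)).measurable
  have hlap : ∫⁻ x, ENNReal.ofReal (Real.exp (-α * x)) ∂(stationaryExcess c ν)
      = (ENNReal.ofReal d)⁻¹ * ENNReal.ofReal (downExponent c ν α / α) := by
    unfold stationaryExcess
    rw [lintegral_smul_measure, lintegral_add_measure, lintegral_smul_measure,
      lintegral_dirac' _ (by fun_prop), lintegral_withDensity_eq_lintegral_mul _ hanti (by fun_prop),
      ofReal_add_lintegral_eq hc hν hd, ← ofReal_downExponent_div hc hν hα,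
      ← lintegral_exp_mul_tail hα]
    simp only [smul_eq_mul, mul_zero, Real.exp_zero, ENNReal.ofReal_one, mul_one, Pi.mul_apply]
    simp_rw [mul_comm (ν _)]
  have hη0 : 0 ≤ downExponent c ν α / α := by
    refine div_nonneg (add_nonneg (by positivity) (setIntegral_nonneg measurableSet_Ioi ?_)) hα.le
    intro x hx
    have hx0 : 0 < x := hx
    have h1 : Real.exp (-α * x) ≤ 1 := Real.exp_le_one_iff.2 (by nlinarith)
    linarith
  rw [integral_eq_lintegral_of_nonneg_ae (ae_of_all _ fun x => (Real.exp_pos _).le) (by fun_prop),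
    hlap, ENNReal.toReal_mul, ENNReal.toReal_inv, ENNReal.toReal_ofReal hd0.le,
    ENNReal.toReal_ofReal hη0]
  field_simp

end StationaryExcess

/-! ### Laplace transform of the Bernoulli mixture. -/

section Mixture

variable {Ω : Type*} {m : MeasurableSpace Ω} {P : Measure Ω}

/-- Product formula for bounded functions of five independent variables. -/
lemma integral_prod_five [IsFiniteMeasure P] {A B C D E : Ω → ℝ}
    (hA : AEMeasurable A P) (hB : AEMeasurable B P)
    (hC : AEMeasurable C P) (hD : AEMeasurable D P) (hE : AEMeasurable E P)
    (hind : iIndepFun ![A, B, C, D, E] P) {a b c d e : ℝ → ℝ}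
    (ha : Measurable a) (hb : Measurable b) (hc : Measurable c) (hd : Measurable d)
    (he : Measurable e) (ha1 : ∀ x, |a x| ≤ 1) (hb1 : ∀ x, |b x| ≤ 1) (hc1 : ∀ x, |c x| ≤ 1)
    (hd1 : ∀ x, |d x| ≤ 1) (he1 : ∀ x, |e x| ≤ 1) :
    Integrable (fun ω => a (A ω) * b (B ω) * c (C ω) * d (D ω) * e (E ω)) P ∧
      ∫ ω, a (A ω) * b (B ω) * c (C ω) * d (D ω) * e (E ω) ∂P
        = (∫ ω, a (A ω) ∂P) * (∫ ω, b (B ω) ∂P) * (∫ ω, c (C ω) ∂P) * (∫ ω, d (D ω) ∂P)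
          * ∫ ω, e (E ω) ∂P := by
  constructor
  · refine Integrable.of_bound (C := 1) ?_ (ae_of_all _ fun ω => ?_)
    · exact (((((ha.comp_aemeasurable hA).mul (hb.comp_aemeasurable hB)).mul
        (hc.comp_aemeasurable hC)).mul (hd.comp_aemeasurable hD)).mul
        (he.comp_aemeasurable hE)).aestronglyMeasurable
    · simp only [Real.norm_eq_abs, abs_mul]
      have h0 : ∀ x : ℝ, 0 ≤ |x| := abs_nonneg
      exact mul_le_one₀ (mul_le_one₀ (mul_le_one₀ (mul_le_one₀ (ha1 _) (h0 _) (hb1 _)) (h0 _)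
        (hc1 _)) (h0 _) (hd1 _)) (h0 _) (he1 _)
  · have key := hind.integral_fun_prod_comp (f := ![a, b, c, d, e])
      (by intro i; fin_cases i <;> assumption)
      (by intro i; fin_cases i <;> exact Measurable.aestronglyMeasurable (by assumption))
    simpa [Fin.prod_univ_five] using key

lemma IsBernoulli.integral_indicator_one {B : Ω → ℝ} {p : ℝ} (h : IsBernoulli B p P) :
    ∫ ω, ({1} : Set ℝ).indicator (1 : ℝ → ℝ) (B ω) ∂P = p := by
  rw [← integral_map h.aemeasurable
    (measurable_one.indicator (measurableSet_singleton 1)).aestronglyMeasurable,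
    MeasureTheory.integral_indicator_one (measurableSet_singleton 1), measureReal_def,
    Measure.map_apply_of_aemeasurable h.aemeasurable (measurableSet_singleton 1)]
  exact h.one

lemma IsBernoulli.integral_indicator_zero {B : Ω → ℝ} {p : ℝ} (h : IsBernoulli B p P) :
    ∫ ω, ({0} : Set ℝ).indicator (1 : ℝ → ℝ) (B ω) ∂P = 1 - p := by
  rw [← integral_map h.aemeasurable
    (measurable_one.indicator (measurableSet_singleton 0)).aestronglyMeasurable,
    MeasureTheory.integral_indicator_one (measurableSet_singleton 0), measureReal_def,
    Measure.map_apply_of_aemeasurable h.aemeasurable (measurableSet_singleton 0)]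
  exact h.zero

lemma IsBernoulli.ae_eq_zero_or_one [IsProbabilityMeasure P] {B : Ω → ℝ} {p : ℝ}
    (h : IsBernoulli B p P) : ∀ᵐ ω ∂P, B ω = 0 ∨ B ω = 1 := by
  have hpr := Measure.isProbabilityMeasure_map h.aemeasurable
  have hms : MeasurableSet ({0, 1} : Set ℝ) := by measurability
  have h0 : (P.map B).real {0} = 1 - p := by
    rw [measureReal_def,
      Measure.map_apply_of_aemeasurable h.aemeasurable (measurableSet_singleton 0)]
    exact h.zero
  have h1 : (P.map B).real {1} = p := by
    rw [measureReal_def,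
      Measure.map_apply_of_aemeasurable h.aemeasurable (measurableSet_singleton 1)]
    exact h.one
  have hu : (P.map B).real {0, 1} = 1 := by
    rw [insert_eq, measureReal_union (by simp) (measurableSet_singleton 1), h0, h1]
    ring
  have hc : (P.map B) ({0, 1}ᶜ : Set ℝ) = 0 := by
    rw [prob_compl_eq_zero_iff hms, ← ofReal_measureReal (measure_ne_top _ _), hu,
      ENNReal.ofReal_one]
  have : ∀ᵐ x ∂(P.map B), x ∈ ({0, 1} : Set ℝ) := hc
  have := ae_of_ae_map h.aemeasurable this
  filter_upwards [this] with ω hω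
  simpa using hω

lemma IsBernoulli.ae_eq_zero [IsProbabilityMeasure P] {B : Ω → ℝ} (h : IsBernoulli B 0 P) :
    ∀ᵐ ω ∂P, B ω = 0 := by
  have h1 : P {ω | B ω = 1} = 0 := by
    rw [← measureReal_eq_zero_iff]; exact h.one
  have h2 : ∀ᵐ ω ∂P, B ω ≠ 1 := by
    rw [ae_iff]; simpa using h1
  filter_upwards [h.ae_eq_zero_or_one, h2] with ω h h' using h.resolve_right h'

variable {U Y L I D : Ω → ℝ} {p q : ℝ}

/-- The variable `L U + (1 - L) (I (U + Y) + D)` for `L, I` with values in `{0, 1}`. -/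
def mixture (U Y L I D : Ω → ℝ) (ω : Ω) : ℝ :=
  L ω * U ω + (1 - L ω) * (I ω * (U ω + Y ω) + D ω)

/-- The alternative in `hY0` covers a subordinator of mean zero, where `Y` has no prescribed sign
but `I` vanishes almost surely. -/
lemma mixture_nonneg [IsProbabilityMeasure P] (hL : IsBernoulli L p P) (hI : IsBernoulli I q P)
    (hU0 : ∀ᵐ ω ∂P, 0 ≤ U ω) (hD0 : ∀ᵐ ω ∂P, 0 ≤ D ω) (hY0 : ∀ᵐ ω ∂P, I ω = 0 ∨ 0 ≤ Y ω) :
    ∀ᵐ ω ∂P, 0 ≤ mixture U Y L I D ω := by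
  filter_upwards [hL.ae_eq_zero_or_one, hI.ae_eq_zero_or_one, hU0, hD0, hY0]
    with ω h1 h2 hU hD hY
  unfold mixture
  rcases h1 with h1 | h1
  · rcases h2 with h2 | h2
    · simpa [h1, h2] using hD
    · have := hY.resolve_left (by rw [h2]; exact one_ne_zero)
      rw [h1, h2]
      linarith
  · simpa [h1] using hU

/-- The Laplace transform of the mixture. -/
lemma laplace_mixture [IsProbabilityMeasure P] (hU : AEMeasurable U P) (hY : AEMeasurable Y P)
    (hD : AEMeasurable D P) (hL : IsBernoulli L p P) (hI : IsBernoulli I q P)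
    (hU0 : ∀ᵐ ω ∂P, 0 ≤ U ω) (hD0 : ∀ᵐ ω ∂P, 0 ≤ D ω) (hY0 : ∀ᵐ ω ∂P, I ω = 0 ∨ 0 ≤ Y ω)
    (hind : iIndepFun ![U, Y, L, I, D] P) {α : ℝ} (hα : 0 ≤ α) :
    ∫ ω, Real.exp (-α * mixture U Y L I D ω) ∂P
      = p * ∫ ω, Real.exp (-α * U ω) ∂P
        + (1 - p) * (1 - q + q * (∫ ω, Real.exp (-α * max (Y ω) 0) ∂P)
          * ∫ ω, Real.exp (-α * U ω) ∂P) * ∫ ω, Real.exp (-α * D ω) ∂P := by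
  -- Truncation at zero makes the exponential bounded on all of `ℝ`, so the product formula applies
  -- even to a `Y` of arbitrary sign.
  set g : ℝ → ℝ := fun x => Real.exp (-α * max x 0) with hg
  have hgm : Measurable g := by fun_prop
  have hg1 : ∀ x, |g x| ≤ 1 := fun x => by
    rw [Real.abs_exp, Real.exp_le_one_iff]
    nlinarith [le_max_right x 0]
  have hind1 : ∀ (s : Set ℝ) (x : ℝ), |s.indicator (1 : ℝ → ℝ) x| ≤ 1 := fun s x => by
    unfold indicator; split_ifs <;> simp
  have hs : ∀ y : ℝ, Measurable (({y} : Set ℝ).indicator (1 : ℝ → ℝ)) := fun y =>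
    measurable_one.indicator (measurableSet_singleton y)
  have h1m : Measurable (fun _ : ℝ => (1 : ℝ)) := measurable_const
  have h11 : ∀ _ : ℝ, |(1 : ℝ)| ≤ 1 := fun _ => by simp
  have hLm := hL.aemeasurable
  have hIm := hI.aemeasurable
  obtain ⟨i1, e1⟩ := integral_prod_five hU hY hLm hIm hD hind hgm h1m (hs 1) h1m h1m hg1 h11
    (hind1 {1}) h11 h11
  obtain ⟨i2, e2⟩ := integral_prod_five hU hY hLm hIm hD hind h1m h1m (hs 0) (hs 0) hgm h11 h11
    (hind1 {0}) (hind1 {0}) hg1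
  obtain ⟨i3, e3⟩ := integral_prod_five hU hY hLm hIm hD hind hgm hgm (hs 0) (hs 1) hgm hg1 hg1
    (hind1 {0}) (hind1 {1}) hg1
  have eU : ∫ ω, g (U ω) ∂P = ∫ ω, Real.exp (-α * U ω) ∂P :=
    integral_congr_ae (by filter_upwards [hU0] with ω hω; simp only [hg, max_eq_left hω])
  have eD : ∫ ω, g (D ω) ∂P = ∫ ω, Real.exp (-α * D ω) ∂P :=
    integral_congr_ae (by filter_upwards [hD0] with ω hω; simp only [hg, max_eq_left hω])
  -- The three terms are the cases `L = 1`, `L = I = 0`, and `L = 0, I = 1`; the factors `1` stand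
  -- for variables absent from a case.
  have hae : (fun ω => Real.exp (-α * mixture U Y L I D ω)) =ᵐ[P] fun ω =>
      (g (U ω) * 1 * ({1} : Set ℝ).indicator (1 : ℝ → ℝ) (L ω) * 1 * 1
      + 1 * 1 * ({0} : Set ℝ).indicator (1 : ℝ → ℝ) (L ω)
        * ({0} : Set ℝ).indicator (1 : ℝ → ℝ) (I ω) * g (D ω))
      + g (U ω) * g (Y ω) * ({0} : Set ℝ).indicator (1 : ℝ → ℝ) (L ω)
        * ({1} : Set ℝ).indicator (1 : ℝ → ℝ) (I ω) * g (D ω) := by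
    filter_upwards [hL.ae_eq_zero_or_one, hI.ae_eq_zero_or_one, hU0, hD0, hY0]
      with ω h1 h2 hU hD hY
    unfold mixture
    simp only [hg, max_eq_left hU, max_eq_left hD]
    rcases h1 with h1 | h1
    · rcases h2 with h2 | h2
      · simp [h1, h2]
      · have hY' := hY.resolve_left (by rw [h2]; exact one_ne_zero)
        rw [max_eq_left hY', h1, h2]
        simp [← Real.exp_add]
        ring
    · simp [h1]
  refine (integral_congr_ae hae).trans ((integral_add (i1.add i2) i3).trans ?_)
  rw [integral_add' i1 i2, e1, e2, e3, eU, eD,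
    hL.integral_indicator_one, hL.integral_indicator_zero, hI.integral_indicator_one,
    hI.integral_indicator_zero]
  simp only [integral_const, probReal_univ, smul_eq_mul, mul_one, one_mul]
  ring

end Mixture

end LevyStorage

/-! ### Assembly of the decomposition theorem. -/

open LevyStorage in
theorem theorem3
    {Ω : Type*} {m : MeasurableSpace Ω} (P : Measure Ω) [IsProbabilityMeasure P]
    (𝓕 : Filtration ℝ≥0 m) (h𝓕 : IsStandardFiltration 𝓕 P)
    -- alternating down and up periods
    (S T : ℕ → Ω → WithTop ℝ≥0) (hST : IsUpDownSchedule S T 𝓕 P)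
    -- the net input during up periods
    (Xu : ℝ≥0 → Ω → ℝ) (hXu : IsLevyProcess Xu 𝓕 P) (hXu_jumps : NoNegativeJumps Xu P)
    (cu σu : ℝ) (νu : Measure ℝ) (hνu : IsLevyMeasure νu)
    (φ : ℝ → ℝ) (hφ : φ = upExponent cu σu νu) (hXuφ : HasLaplaceExponent Xu φ P)
    (hXu_int : Integrable (Xu 1) P) (hXu_neg : ∫ ω, Xu 1 ω ∂P < 0)
    -- the input during down periods
    (Xd : ℝ≥0 → Ω → ℝ) (hXd : IsSubordinator Xd 𝓕 P)
    (cd : ℝ) (hcd : 0 ≤ cd) (νd : Measure ℝ) (hνd : IsSubordinatorLevyMeasure νd)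
    (η : ℝ → ℝ) (hη : η = downExponent cd νd) (hXdη : HasLaplaceExponent Xd (fun α => -η α) P)
    (hXd_int : Integrable (Xd 1) P)
    -- the content process `W` and the indicator `J` of down periods
    (W0 : Ω → ℝ) (hW0 : Measurable[𝓕 0] W0)
    (W J : ℝ≥0 → Ω → ℝ) (hW : W = content S T Xu Xd W0) (hJ : J = downIndicator S T)
    -- the ergodic limit `W(∞)`
    {Ω₁ : Type*} {m₁ : MeasurableSpace Ω₁} (P₁ : Measure Ω₁) [IsProbabilityMeasure P₁]
    (Winf : Ω₁ → ℝ) (hWinf : IsErgodicLimit W P Winf P₁)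
    -- the long-run fraction of down time
    (φ' η' : ℝ) (hφ' : φ' = rightDerivZero φ) (hη' : η' = rightDerivZero η)
    (pd : ℝ) (hpd : ∀ᵐ ω ∂P, Tendsto (fun t : ℝ => (1 / t) * timeIntegral J t ω) atTop (𝓝 pd))
    (hpd_le : pd ≤ φ' / (η' + φ'))
    (πl π : ℝ) (hπl : πl = 1 - (1 + η' / φ') * pd) (hπ : π = η' / (η' + φ'))
    -- the independent ingredients of the decomposition
    {Ω₂ : Type*} {m₂ : MeasurableSpace Ω₂} (P₂ : Measure Ω₂) [IsProbabilityMeasure P₂]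
    (Wu Ye Il I Wd : Ω₂ → ℝ)
    (hWu : IdentDistrib Wu (fun ω => ⨆ s : ℝ≥0, Xu s ω) P₂ P)
    (hYe_meas : AEMeasurable Ye P₂) (hYe : 0 < η' → HasLaw Ye (stationaryExcess cd νd) P₂)
    (hIl : IsBernoulli Il πl P₂) (hI : IsBernoulli I π P₂)
    (hWd : IsDownLimit W J pd P Wd P₂)
    (hindep : iIndepFun ![Wu, Ye, Il, I, Wd] P₂) :
    (∀ᵐ ω ∂P, BddAbove (Set.range fun s : ℝ≥0 => Xu s ω)) ∧
    (∀ α : ℝ, 0 < α → ∫ ω, Real.exp (-α * Wu ω) ∂P₂ = α * φ' / φ α) ∧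
    (0 < η' → ∀ α : ℝ, 0 < α → ∫ ω, Real.exp (-α * Ye ω) ∂P₂ = η α / (η' * α)) ∧
    ((∀ α : ℝ, 0 < α →
        ∫ ω, Real.exp (-α * Winf ω) ∂P₁ =
          πl * (φ' * α / φ α)
            + (1 - πl) * (1 - π + π * (η α / (η' * α)) * (φ' * α / φ α))
              * ∫ ω, Real.exp (-α * Wd ω) ∂P₂) ↔
      IdentDistrib Winf
        (fun ω => Il ω * Wu ω + (1 - Il ω) * (I ω * (Wu ω + Ye ω) + Wd ω)) P₁ P₂) := by
  obtain ⟨C, hC⟩ := exists_upExponent_le (c := cu) (σ := σu) hνu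
  rw [← hφ] at hC
  have hφd := hXuφ.hasDerivWithinAt_zero hXu_int
  have hφ'_eq : φ' = -∫ ω, Xu 1 ω ∂P := by
    rw [hφ']; exact hφd.derivWithin (uniqueDiffWithinAt_Ici 0)
  have hφ'_pos : 0 < φ' := by rw [hφ'_eq]; linarith
  have hηd : HasDerivWithinAt η (∫ ω, Xd 1 ω ∂P) (Ici 0) 0 := by
    have h := (hXdη.hasDerivWithinAt_zero hXd_int).neg
    rw [neg_neg] at h
    exact h.congr_of_eventuallyEq (Eventually.of_forall fun α => by simp) (by simp)
  have hη'_eq : η' = ∫ ω, Xd 1 ω ∂P := by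
    rw [hη']; exact hηd.derivWithin (uniqueDiffWithinAt_Ici 0)
  have hη'_nonneg : 0 ≤ η' := by
    rw [hη'_eq]
    refine integral_nonneg_of_ae ?_
    filter_upwards [hXd.mono, hXd.levy.zero] with ω hm h0
    have := hm (zero_le (a := (1 : ℝ≥0)))
    simpa [h0] using this
  have hsup := hXu.ae_sup hXuφ hC hXu_int hXu_neg
  have hWu_laplace : ∀ α : ℝ, 0 < α → ∫ ω, Real.exp (-α * Wu ω) ∂P₂ = α * φ' / φ α := by
    intro α hα
    have h1 := (hWu.comp (u := fun x => Real.exp (-α * x)) (by fun_prop)).integral_eq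
    simp only [Function.comp_def] at h1
    rw [h1, hXu.laplace_sup hXuφ hC hXu_int hXu_neg hα, hφ'_eq]
  have hYe_laplace : 0 < η' → ∀ α : ℝ, 0 < α →
      ∫ ω, Real.exp (-α * Ye ω) ∂P₂ = η α / (η' * α) := by
    intro hpos α hα
    have h1 := (hYe hpos).integral_comp (f := fun x => Real.exp (-α * x)) (by fun_prop)
    simp only [Function.comp_def] at h1
    rw [← hη'_eq] at hηd
    rw [hη] at hηd ⊢
    rw [h1, laplace_stationaryExcess hcd hνd hpos hηd hα]
  refine ⟨hsup.mono fun ω hω => hω.1, hWu_laplace, hYe_laplace, ?_⟩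
  have hWu_meas : AEMeasurable Wu P₂ := hWu.aemeasurable_fst
  have hWu0 : ∀ᵐ ω ∂P₂, 0 ≤ Wu ω :=
    hWu.symm.ae_snd measurableSet_Ici (hsup.mono fun ω hω => hω.2.1)
  have hYe0 : 0 < η' → ∀ᵐ ω ∂P₂, 0 ≤ Ye ω := fun hpos => by
    have h1 : P₂.map Ye (Iio 0) = 0 := by rw [(hYe hpos).map_eq]; exact stationaryExcess_Iio
    rw [Measure.map_apply_of_aemeasurable hYe_meas measurableSet_Iio] at h1
    rw [ae_iff]
    simpa [Set.preimage, Iio] using h1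
  have hIYe : ∀ᵐ ω ∂P₂, I ω = 0 ∨ 0 ≤ Ye ω := by
    rcases hη'_nonneg.eq_or_lt with h0 | hpos
    · have hπ0 : π = 0 := by rw [hπ, ← h0, zero_div]
      rw [hπ0] at hI
      exact hI.ae_eq_zero.mono fun ω hω => Or.inl hω
    · exact (hYe0 hpos).mono fun ω hω => Or.inr hω
  have hmix : ∀ α : ℝ, 0 < α → ∫ ω, Real.exp (-α * mixture Wu Ye Il I Wd ω) ∂P₂
      = πl * (φ' * α / φ α)
        + (1 - πl) * (1 - π + π * (η α / (η' * α)) * (φ' * α / φ α))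
          * ∫ ω, Real.exp (-α * Wd ω) ∂P₂ := by
    intro α hα
    rw [laplace_mixture hWu_meas hYe_meas hWd.aemeasurable hIl hI hWu0 hWd.nonneg hIYe hindep hα.le,
      hWu_laplace α hα, mul_comm α φ']
    -- If `η' = 0`, the factor `π = 0` removes both the transform of the arbitrary `Ye` and the
    -- quotient with denominator zero.
    rcases hη'_nonneg.eq_or_lt with h0 | hpos
    · have hπ0 : π = 0 := by rw [hπ, ← h0, zero_div]
      simp [hπ0]
    · have e : ∫ ω, Real.exp (-α * max (Ye ω) 0) ∂P₂ = η α / (η' * α) := by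
        rw [← hYe_laplace hpos α hα]
        refine integral_congr_ae ?_
        filter_upwards [hYe0 hpos] with ω hω
        rw [max_eq_left hω]
      rw [e]
  change _ ↔ IdentDistrib Winf (mixture Wu Ye Il I Wd) P₁ P₂
  have hmix_meas : AEMeasurable (mixture Wu Ye Il I Wd) P₂ := by
    have := hIl.aemeasurable
    have := hI.aemeasurable
    have := hWd.aemeasurable
    unfold mixture
    fun_prop
  constructor
  · intro h
    refine identDistrib_of_laplace hWinf.aemeasurable hmix_meas hWinf.nonneg
      (mixture_nonneg hIl hI hWu0 hWd.nonneg hIYe) fun α hα => ?_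
    rw [h α hα, hmix α hα]
  · intro h α hα
    rw [← hmix α hα]
    exact (h.comp (u := fun x => Real.exp (-α * x)) (by fun_prop)).integral_eq
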